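/- Let $Var$ be a countably infinite set of propositional variables. Formulas of the counterfactual logic $\mathbf P$ are built from variables by $\neg,\lor$ and the counterfactual $\rightsquigarrow$; formulas of the Ockhamist branching time logic OBTL are built from variables by $\neg,\lor,G,H,\Box$; formulas of the joint language are built from variables by all of these connectives. The other Boolean connectives are the usual abbreviations, and $F=\neg G\neg$, $P=\neg H\neg$, $\Diamond=\neg\Box\neg$. **Axioms.** $\mathbf P$ (Burgess) consists of all propositional tautologies and modus ponens, the schemas (CI) $\phi\rightsquigarrow\phi$; (CC) $(\phi\rightsquigarrow\psi)\land(\phi\rightsquigarrow\chi)\to(\phi\rightsquigarrow\psi\land\chi)$; (CW) $(\phi\rightsquigarrow\psi)\to(\phi\rightsquigarrow\psi\lor\chi)$; (SA) $(\phi\rightsquigarrow\psi)\land(\phi\rightsquigarrow\chi)\to(\phi\land\psi\rightsquigarrow\chi)$; (AD) $(\phi\rightsquigarrow\chi)\land(\psi\rightsquigarrow\chi)\to(\phi\lor\psi\rightsquigarrow\chi)$; and the rules: from $\phi\leftrightarrow\psi$ infer $(\phi\rightsquigarrow\chi)\leftrightarrow(\psi\rightsquigarrow\chi)$ and $(\chi\rightsquigarrow\phi)\leftrightarrow(\chi\rightsquigarrow\psi)$.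 OBTL (Reynolds) consists of all propositional tautologies and modus ponens, K4 for $G$ and for $H$, S5 for $\Box$, the schemas $\phi\to GP\phi$; $\phi\to HF\phi$; $F\phi\to G(F\phi\lor\phi\lor P\phi)$; $P\phi\to H(P\phi\lor\phi\lor F\phi)$; $H\Box\phi\to\Box H\phi$; $P\Box\phi\to\Box P\phi$; $\Box G\phi\to G\Box\phi$; $G\bot\to\Box G\bot$; the necessitation rules for $\Box,G,H$; and the irreflexivity rule: from $(p\land H\neg p)\to\phi$ infer $\phi$, if the variable $p$ does not occur in $\phi$. The fusion $\mathcal L_{PBT}=\mathbf P\bigoplus OBTL$ consists of all these axiom schemas and rules, taken over the joint language. **Frames.** A branching time frame $\langle M,\mathcal H,\succ\rangle$ consists of a nonempty countable set $M$ of moments, a strict partial order $\succ$ on $M$ ($m\succ n$ means that $m$ is earlier than $n$) that is backward linear (if $m\succ k$ and $n\succ k$ then $n\succ m$ or $m\succ n$ or $m=n$), and a set $\mathcal H$ of maximal linearly ordered subsets of $M$, the histories. Its points are the pairs $m/h$ with $h\in\mathcal H$ and $m\in h$; variables denote sets of points, $G$ and $H$ quantify over the points $m'/h$ of the same history with $m\succ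 m'$, respectively $m'\succ m$, and $\Box$ over the points $m/h'$ of the same moment. A combined frame $\langle W,\succ,R_\Box,\langle\lessdot_w\rangle_{w\in W}\rangle$ consists of a nonempty countable set $W$; relations $\succ,R_\Box$ on $W$ such that $\langle W,\succ,R_\Box\rangle$ is isomorphic to the set of all points of some branching time frame with the relations "earlier in the same history" and "at the same moment"; and, for each $w\in W$, a set $W_w\subseteq W$ and a strict partial order $\lessdot_w$ on $W_w$ ($x\lessdot_w y$ means that $x$ is more similar to $w$ than $y$ is) that satisfies the Limit Assumption: for all $X\subseteq W_w$ and $x\in X$ there is $y\in X$ with $y=x$ or $y\lessdot_w x$ such that $z\lessdot_w y$ for no $z\in X$. Truth at worlds is defined with $\succ$ for $G,H$, with $R_\Box$ for $\Box$, and $\phi\rightsquigarrow\psi$ is true at $w$ iff $\psi$ is true at every $v\in W_w$ at which $\phi$ is true and for which no $u\in W_w$ with $u\lessdot_w v$ makes $\phi$ true. A formula is valid on a class of frames if it is true at every world (point) of every frame in it under every valuation. **Claim.** (i) Soundness: every theorem of $\mathcal L_{PBT}$ is valid on all combined frames. (ii) Completeness: if every OBTL formula that is valid on all branching time frames is a theorem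 of OBTL, then every formula of the joint language that is valid on all combined frames is a theorem of $\mathcal L_{PBT}$. (iii) $\mathcal L_{PBT}$ is a conservative extension of $\mathbf P$ and of OBTL: a $\mathbf P$ formula is a theorem of $\mathcal L_{PBT}$ iff it is a theorem of $\mathbf P$, and an OBTL formula is a theorem of $\mathcal L_{PBT}$ iff it is a theorem of OBTL. -/

import Mathlib

/-! Propositional variables are the natural numbers. -/

namespace PBT

/-- The language of the counterfactual logic **P**. -/
inductive PForm where
  | var (p : ℕ)
  | neg (φ : PForm)
  | disj (φ ψ : PForm)
  /-- `φ ⇝ ψ`: if it were `φ`, it would be `ψ` -/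
  | cf (φ ψ : PForm)

namespace PForm

def conj (φ ψ : PForm) : PForm := neg (disj (neg φ) (neg ψ))

def imp (φ ψ : PForm) : PForm := disj (neg φ) ψ

def biimp (φ ψ : PForm) : PForm := conj (imp φ ψ) (imp ψ φ)

/-- Tautologies of classical propositional logic in this language: formulas true under every
assignment of truth values that respects `¬` and `∨` and is otherwise arbitrary. -/
def Taut (φ : PForm) : Prop :=
  ∀ v : PForm → Prop, (∀ a, v (neg a) ↔ ¬ v a) → (∀ a b, v (disj a b) ↔ (v a ∨ v b)) → v φ

/-- Theorems of Burgess's minimal counterfactual logic **P**. -/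
inductive Prov : PForm → Prop where
  -- common to both systems: tautologies and modus ponens
  | taut (φ) : Taut φ → Prov φ
  | mp (φ ψ) : Prov φ → Prov (imp φ ψ) → Prov ψ
  -- counterfactual axioms and rules
  | ci (φ) : Prov (cf φ φ)
  | cc (φ ψ χ) : Prov (imp (conj (cf φ ψ) (cf φ χ)) (cf φ (conj ψ χ)))
  | cw (φ ψ χ) : Prov (imp (cf φ ψ) (cf φ (disj ψ χ)))
  | sa (φ ψ χ) : Prov (imp (conj (cf φ ψ) (cf φ χ)) (cf (conj φ ψ) χ))
  | ad (φ ψ χ) : Prov (imp (conj (cf φ χ) (cf ψ χ)) (cf (disj φ ψ) χ))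
  | rea (φ ψ χ) : Prov (biimp φ ψ) → Prov (biimp (cf φ χ) (cf ψ χ))
  | recq (φ ψ χ) : Prov (biimp φ ψ) → Prov (biimp (cf χ φ) (cf χ ψ))

end PForm

/-- The language of the Ockhamist branching time logic OBTL. -/
inductive OForm where
  | var (p : ℕ)
  | neg (φ : OForm)
  | disj (φ ψ : OForm)
  /-- at every later moment of the history -/
  | G (φ : OForm)
  /-- at every earlier moment of the history -/
  | H (φ : OForm)
  /-- historical necessity -/
  | box (φ : OForm)

namespace OForm

def conj (φ ψ : OForm) : OForm := neg (disj (neg φ) (neg ψ))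

def imp (φ ψ : OForm) : OForm := disj (neg φ) ψ

def biimp (φ ψ : OForm) : OForm := conj (imp φ ψ) (imp ψ φ)

/-- at some later moment of the history -/
def F (φ : OForm) : OForm := neg (G (neg φ))

/-- at some earlier moment of the history -/
def P (φ : OForm) : OForm := neg (H (neg φ))

/-- historical possibility -/
def dia (φ : OForm) : OForm := neg (box (neg φ))

/-- The variable `p` occurs in the formula. -/
def Occurs (p : ℕ) : OForm → Prop
  | var q => p = q
  | neg φ => Occurs p φ
  | disj φ ψ => Occurs p φ ∨ Occurs p ψ
  | G φ => Occurs p φ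
  | H φ => Occurs p φ
  | box φ => Occurs p φ

/-- Tautologies of classical propositional logic in this language: formulas true under every
assignment of truth values that respects `¬` and `∨` and is otherwise arbitrary. -/
def Taut (φ : OForm) : Prop :=
  ∀ v : OForm → Prop, (∀ a, v (neg a) ↔ ¬ v a) → (∀ a b, v (disj a b) ↔ (v a ∨ v b)) → v φ

/-- Theorems of the Ockhamist branching time logic OBTL. -/
inductive Prov : OForm → Prop where
  -- common to both systems: tautologies and modus ponens
  | taut (φ) : Taut φ → Prov φ
  | mp (φ ψ) : Prov φ → Prov (imp φ ψ) → Prov ψ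
  -- K4 for `G` and for `H`
  | kG (φ ψ) : Prov (imp (G (imp φ ψ)) (imp (G φ) (G ψ)))
  | fourG (φ) : Prov (imp (G φ) (G (G φ)))
  | kH (φ ψ) : Prov (imp (H (imp φ ψ)) (imp (H φ) (H ψ)))
  | fourH (φ) : Prov (imp (H φ) (H (H φ)))
  -- S5 for `□`
  | kBox (φ ψ) : Prov (imp (box (imp φ ψ)) (imp (box φ) (box ψ)))
  | tBox (φ) : Prov (imp (box φ) φ)
  | fiveBox (φ) : Prov (imp (dia φ) (box (dia φ)))
  -- time and historical necessity
  | l1 (φ) : Prov (imp φ (G (P φ)))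
  | l1p (φ) : Prov (imp φ (H (F φ)))
  | l2 (φ) : Prov (imp (F φ) (G (disj (F φ) (disj φ (P φ)))))
  | l2p (φ) : Prov (imp (P φ) (H (disj (P φ) (disj φ (F φ)))))
  | l3 (φ) : Prov (imp (H (box φ)) (box (H φ)))
  | l4 (φ) : Prov (imp (P (box φ)) (box (P φ)))
  | l5 (φ) : Prov (imp (box (G φ)) (G (box φ)))
  -- `G ⊥ → □ G ⊥`, with `⊥` any formula of the form `φ ∧ ¬ φ`
  | l6 (φ) : Prov (imp (G (conj φ (neg φ))) (box (G (conj φ (neg φ)))))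
  -- necessitation rules and the irreflexivity rule
  | necBox (φ) : Prov φ → Prov (box φ)
  | necG (φ) : Prov φ → Prov (G φ)
  | necH (φ) : Prov φ → Prov (H φ)
  | irr (p : ℕ) (φ) : ¬ Occurs p φ → Prov (imp (conj (var p) (H (neg (var p)))) φ) → Prov φ

end OForm

/-- The joint language of **P** and OBTL. -/
inductive Form where
  | var (p : ℕ)
  | neg (φ : Form)
  | disj (φ ψ : Form)
  /-- `φ ⇝ ψ`: if it were `φ`, it would be `ψ` -/
  | cf (φ ψ : Form)
  /-- at every later moment of the history -/
  | G (φ : Form)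
  /-- at every earlier moment of the history -/
  | H (φ : Form)
  /-- historical necessity -/
  | box (φ : Form)

namespace Form

def conj (φ ψ : Form) : Form := neg (disj (neg φ) (neg ψ))

def imp (φ ψ : Form) : Form := disj (neg φ) ψ

def biimp (φ ψ : Form) : Form := conj (imp φ ψ) (imp ψ φ)

/-- at some later moment of the history -/
def F (φ : Form) : Form := neg (G (neg φ))

/-- at some earlier moment of the history -/
def P (φ : Form) : Form := neg (H (neg φ))

/-- historical possibility -/
def dia (φ : Form) : Form := neg (box (neg φ))

/-- The variable `p` occurs in the formula. -/
def Occurs (p : ℕ) : Form → Prop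
  | var q => p = q
  | neg φ => Occurs p φ
  | disj φ ψ => Occurs p φ ∨ Occurs p ψ
  | cf φ ψ => Occurs p φ ∨ Occurs p ψ
  | G φ => Occurs p φ
  | H φ => Occurs p φ
  | box φ => Occurs p φ

/-- Tautologies of classical propositional logic in this language: formulas true under every
assignment of truth values that respects `¬` and `∨` and is otherwise arbitrary. -/
def Taut (φ : Form) : Prop :=
  ∀ v : Form → Prop, (∀ a, v (neg a) ↔ ¬ v a) → (∀ a b, v (disj a b) ↔ (v a ∨ v b)) → v φ

/-- Theorems of the fusion: all axiom schemas and all rules of **P** and of OBTL, taken over the joint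
language. -/
inductive Prov : Form → Prop where
  -- common to both systems: tautologies and modus ponens
  | taut (φ) : Taut φ → Prov φ
  | mp (φ ψ) : Prov φ → Prov (imp φ ψ) → Prov ψ
  -- counterfactual axioms and rules
  | ci (φ) : Prov (cf φ φ)
  | cc (φ ψ χ) : Prov (imp (conj (cf φ ψ) (cf φ χ)) (cf φ (conj ψ χ)))
  | cw (φ ψ χ) : Prov (imp (cf φ ψ) (cf φ (disj ψ χ)))
  | sa (φ ψ χ) : Prov (imp (conj (cf φ ψ) (cf φ χ)) (cf (conj φ ψ) χ))
  | ad (φ ψ χ) : Prov (imp (conj (cf φ χ) (cf ψ χ)) (cf (disj φ ψ) χ))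
  | rea (φ ψ χ) : Prov (biimp φ ψ) → Prov (biimp (cf φ χ) (cf ψ χ))
  | recq (φ ψ χ) : Prov (biimp φ ψ) → Prov (biimp (cf χ φ) (cf χ ψ))
  -- K4 for `G` and for `H`
  | kG (φ ψ) : Prov (imp (G (imp φ ψ)) (imp (G φ) (G ψ)))
  | fourG (φ) : Prov (imp (G φ) (G (G φ)))
  | kH (φ ψ) : Prov (imp (H (imp φ ψ)) (imp (H φ) (H ψ)))
  | fourH (φ) : Prov (imp (H φ) (H (H φ)))
  -- S5 for `□`
  | kBox (φ ψ) : Prov (imp (box (imp φ ψ)) (imp (box φ) (box ψ)))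
  | tBox (φ) : Prov (imp (box φ) φ)
  | fiveBox (φ) : Prov (imp (dia φ) (box (dia φ)))
  -- time and historical necessity
  | l1 (φ) : Prov (imp φ (G (P φ)))
  | l1p (φ) : Prov (imp φ (H (F φ)))
  | l2 (φ) : Prov (imp (F φ) (G (disj (F φ) (disj φ (P φ)))))
  | l2p (φ) : Prov (imp (P φ) (H (disj (P φ) (disj φ (F φ)))))
  | l3 (φ) : Prov (imp (H (box φ)) (box (H φ)))
  | l4 (φ) : Prov (imp (P (box φ)) (box (P φ)))
  | l5 (φ) : Prov (imp (box (G φ)) (G (box φ)))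
  -- `G ⊥ → □ G ⊥`, with `⊥` any formula of the form `φ ∧ ¬ φ`
  | l6 (φ) : Prov (imp (G (conj φ (neg φ))) (box (G (conj φ (neg φ)))))
  -- necessitation rules and the irreflexivity rule
  | necBox (φ) : Prov φ → Prov (box φ)
  | necG (φ) : Prov φ → Prov (G φ)
  | necH (φ) : Prov φ → Prov (H φ)
  | irr (p : ℕ) (φ) : ¬ Occurs p φ → Prov (imp (conj (var p) (H (neg (var p)))) φ) → Prov φ

end Form

/-- A formula of **P**, read in the joint language. -/
def PForm.toForm : PForm → Form
  | .var p => .var p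
  | .neg φ => .neg φ.toForm
  | .disj φ ψ => .disj φ.toForm ψ.toForm
  | .cf φ ψ => .cf φ.toForm ψ.toForm

/-- A formula of OBTL, read in the joint language. -/
def OForm.toForm : OForm → Form
  | .var p => .var p
  | .neg φ => .neg φ.toForm
  | .disj φ ψ => .disj φ.toForm ψ.toForm
  | .G φ => .G φ.toForm
  | .H φ => .H φ.toForm
  | .box φ => .box φ.toForm

/-- Branching time frames `⟨M, H, ≻⟩`: a nonempty countable set of moments, a backward linear strict
partial order, and a set of histories, each of which is a maximal linearly ordered set of moments. -/
structure BTFrame where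
  M : Type
  nonempty : Nonempty M
  countable : Countable M
  /-- `earlier m n`, written `m ≻ n`: the moment `m` comes earlier than `n` -/
  earlier : M → M → Prop
  irrefl : ∀ m, ¬ earlier m m
  trans : ∀ m n k, earlier m n → earlier n k → earlier m k
  backward_linear : ∀ m n k, earlier m k → earlier n k → earlier n m ∨ earlier m n ∨ m = n
  histories : Set (Set M)
  maximal : ∀ h ∈ histories, IsMaxChain earlier h

namespace BTFrame

/-- The points `m/h`, with `h` a history and `m ∈ h`. -/
structure Point (F : BTFrame) where
  moment : F.M
  history : Set F.M
  history_mem : history ∈ F.histories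
  moment_mem : moment ∈ history

variable (F : BTFrame)

/-- The earlier-than relation between points: an earlier moment in the same history. -/
def pointEarlier (x y : F.Point) : Prop := x.history = y.history ∧ F.earlier x.moment y.moment

/-- Historical accessibility between points: the same moment, in possibly different histories. -/
def sameMoment (x y : F.Point) : Prop := x.moment = y.moment

/-- Truth of an OBTL formula at a point, for the valuation `V`. -/
def Sat (V : ℕ → Set F.Point) : F.Point → OForm → Prop
  | x, .var p => x ∈ V p
  | x, .neg φ => ¬ Sat V x φ
  | x, .disj φ ψ => Sat V x φ ∨ Sat V x ψ
  | x, .G φ => ∀ y, F.pointEarlier x y → Sat V y φ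
  | x, .H φ => ∀ y, F.pointEarlier y x → Sat V y φ
  | x, .box φ => ∀ y, F.sameMoment x y → Sat V y φ

end BTFrame

/-- Validity of an OBTL formula on all branching time frames. -/
def OForm.Valid (φ : OForm) : Prop :=
  ∀ (F : BTFrame) (V : ℕ → Set F.Point) (x : F.Point), F.Sat V x φ

/-- Combined frames `⟨W, ≻, R_□, ⟨⋖_w⟩⟩`. -/
structure Frame where
  W : Type
  nonempty : Nonempty W
  countable : Countable W
  /-- `earlier x y`, written `x ≻ y` -/
  earlier : W → W → Prop
  /-- `R_□` -/
  rBox : W → W → Prop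
  /-- `(W, ≻, R_□)` is, up to isomorphism, the set of all points of a branching time frame with the
  relations "earlier in the same history" and "at the same moment". -/
  branching : ∃ (F : BTFrame) (e : W ≃ F.Point),
    (∀ x y, earlier x y ↔ F.pointEarlier (e x) (e y)) ∧
    (∀ x y, rBox x y ↔ F.sameMoment (e x) (e y))
  /-- the set `W_w` of worlds accessible from `w` -/
  acc : W → Set W
  /-- `closer w x y`, written `x ⋖_w y`: `x` is more similar to `w` than `y` is -/
  closer : W → W → W → Prop
  closer_mem : ∀ w x y, closer w x y → x ∈ acc w ∧ y ∈ acc w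
  closer_irrefl : ∀ w x, ¬ closer w x x
  closer_trans : ∀ w x y z, closer w x y → closer w y z → closer w x z
  /-- Limit Assumption: every element of a set `X` of accessible worlds is a most similar element of
  `X` or is preceded by one. -/
  limit : ∀ w, ∀ X ⊆ acc w, ∀ x ∈ X,
    ∃ y ∈ X, (y = x ∨ closer w y x) ∧ ∀ z ∈ X, ¬ closer w z y

namespace Frame

variable (F : Frame)

/-- Truth of a formula at a world, for the valuation `V`. A counterfactual `φ ⇝ ψ` is true at `w` if
`ψ` is true at those accessible `φ`-worlds than which no accessible `φ`-world is more similar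
to `w`. -/
def Sat (V : ℕ → Set F.W) : F.W → Form → Prop
  | w, .var p => w ∈ V p
  | w, .neg φ => ¬ Sat V w φ
  | w, .disj φ ψ => Sat V w φ ∨ Sat V w ψ
  | w, .cf φ ψ => ∀ v ∈ F.acc w, Sat V v φ →
      (∀ u ∈ F.acc w, Sat V u φ → ¬ F.closer w u v) → Sat V v ψ
  | w, .G φ => ∀ v, F.earlier w v → Sat V v φ
  | w, .H φ => ∀ v, F.earlier v w → Sat V v φ
  | w, .box φ => ∀ v, F.rBox w v → Sat V v φ

end Frame

/-- Validity of a formula on all combined frames. -/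
def Form.Valid (φ : Form) : Prop :=
  ∀ (F : Frame) (V : ℕ → Set F.W) (w : F.W), F.Sat V w φ

end PBT

namespace PBT

/-! ### Translations between the languages and conservativity -/

/-! Conservativity is syntactic. Erasing time (`toPForm`) and reading `⇝` as material implication
(`toOForm`) send theorems of the fusion to theorems of **P** and of OBTL, and each translation is
the identity on formulas of its target language.

Soundness is a check of each axiom and rule. SA rests on the Limit Assumption; the axioms linking
time and `□` rest on two facts: histories are closed under earlier moments, and a moment that is
last in one history is last in all.

Completeness is an induction on the nesting depth of `⇝`, showing that every consistent `φ` has a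
model (`exists_model`). Replace the outermost counterfactuals of `φ` by variables; completeness of
OBTL then satisfies the result at a point of a branching time frame, which may be taken to have
countably many points. The new variables could take values that no maximal consistent set gives to
the counterfactuals, so one satisfies `φ ∧ guard θ φ` instead, where the theorem `θ` excludes such
values and `guard` carries it along the evaluation of `φ`. At each point where `θ` holds, the
counterfactuals now have their values from some maximal consistent set. The conditional induced by
that set on conditions over finitely many formulas is a preferential choice function, and the
representation theorem of Kraus, Lehmann and Magidor (`PrefState.subset_iff`) yields a finite strict
order of states labelled by maximal consistent sets. The antecedents and consequents have smaller
depth, so by induction each label is realised, as far as these formulas go, by a pointed model.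
Grafting these models onto the points as disjoint components gives a model of `φ`, since branching
time frames are closed under countable nonempty disjoint unions. -/

theorem Form.Prov.mono_taut {φ ψ : Form} (h : φ.Prov) (t : (Form.imp φ ψ).Taut) : ψ.Prov :=
  .mp _ _ h (.taut _ t)

theorem Form.Prov.mono_taut₂ {φ ψ χ : Form} (h : φ.Prov) (h' : ψ.Prov)
    (t : (Form.imp φ (Form.imp ψ χ)).Taut) : χ.Prov :=
  .mp _ _ h' (.mp _ _ h (.taut _ t))

namespace PForm

/-- Uniform substitution. -/
def subst (σ : ℕ → PForm) : PForm → PForm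
  | var p => σ p
  | neg φ => neg (subst σ φ)
  | disj φ ψ => disj (subst σ φ) (subst σ ψ)
  | cf φ ψ => cf (subst σ φ) (subst σ ψ)

theorem Prov.subst {φ : PForm} (h : φ.Prov) (σ : ℕ → PForm) : (φ.subst σ).Prov := by
  induction h with
  | taut φ t =>
    exact .taut _ fun v hn hd => t (fun a => v (a.subst σ)) (fun _ => hn _) (fun _ _ => hd _ _)
  | mp φ ψ _ _ h₁ h₂ => exact .mp _ _ h₁ h₂
  | ci => exact .ci _
  | cc => exact .cc _ _ _
  | cw => exact .cw _ _ _
  | sa => exact .sa _ _ _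
  | ad => exact .ad _ _ _
  | rea φ ψ χ _ h => exact .rea _ _ _ h
  | recq φ ψ χ _ h => exact .recq _ _ _ h

theorem Prov.toForm {φ : PForm} (h : φ.Prov) : φ.toForm.Prov := by
  induction h with
  | taut φ t =>
    exact .taut _ fun v hn hd => t (fun a => v a.toForm) (fun _ => hn _) (fun _ _ => hd _ _)
  | mp φ ψ _ _ h₁ h₂ => exact .mp _ _ h₁ h₂
  | ci => exact .ci _
  | cc => exact .cc _ _ _
  | cw => exact .cw _ _ _
  | sa => exact .sa _ _ _
  | ad => exact .ad _ _ _
  | rea φ ψ χ _ h => exact .rea _ _ _ h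
  | recq φ ψ χ _ h => exact .recq _ _ _ h

end PForm

namespace Form

/-- The reading of a formula in a frame without earlier or later moments and with a single history
through each moment: `G` and `H` become trivially true, and `□` vanishes. -/
def toPForm : Form → PForm
  | var p => .var p
  | neg φ => .neg φ.toPForm
  | disj φ ψ => .disj φ.toPForm ψ.toPForm
  | cf φ ψ => .cf φ.toPForm ψ.toPForm
  | G φ => .disj φ.toPForm (.neg φ.toPForm)
  | H φ => .disj φ.toPForm (.neg φ.toPForm)
  | box φ => φ.toPForm

theorem toPForm_toForm (φ : PForm) : φ.toForm.toPForm = φ := by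
  induction φ <;> simp_all [PForm.toForm, toPForm]

theorem subst_toPForm_of_not_occurs {p : ℕ} {τ : PForm} {φ : Form} (h : ¬ Occurs p φ) :
    φ.toPForm.subst (Function.update .var p τ) = φ.toPForm := by
  induction φ with
  | var q =>
    have : q ≠ p := fun e => h e.symm
    simp [toPForm, PForm.subst, Function.update_of_ne this]
  | _ => simp_all [toPForm, PForm.subst, Occurs]

theorem Prov.toPForm {φ : Form} (h : φ.Prov) : φ.toPForm.Prov := by
  induction h with
  | taut φ t =>
    exact .taut _ fun v hn hd => t (fun a => v a.toPForm) (fun _ => hn _) (fun _ _ => hd _ _)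
  | mp φ ψ _ _ h₁ h₂ => exact .mp _ _ h₁ h₂
  | ci => exact .ci _
  | cc => exact .cc _ _ _
  | cw => exact .cw _ _ _
  | sa => exact .sa _ _ _
  | ad => exact .ad _ _ _
  | rea φ ψ χ _ h => exact .rea _ _ _ h
  | recq φ ψ χ _ h => exact .recq _ _ _ h
  | necBox φ _ h => exact h
  | irr p φ hp _ h =>
    -- The translation of `H ¬p` is already a tautology. Putting a tautology for `p` makes the whole
    -- premise one, and leaves `φ` alone because `p` does not occur in it.
    have h' := h.subst (Function.update .var p (.disj (.var 0) (.neg (.var 0))))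
    simp only [Form.imp, Form.conj, Form.toPForm, PForm.subst, Function.update_self,
      subst_toPForm_of_not_occurs hp] at h'
    refine .mp _ _ h' (.taut _ fun v hn hd => ?_)
    simp only [PForm.imp, hn, hd]
    tauto
  | _ =>
    refine .taut _ fun v hn hd => ?_
    simp only [Form.imp, Form.conj, Form.F, Form.P, Form.dia, Form.toPForm, hn, hd]
    tauto

end Form

theorem PForm.prov_toForm_iff (φ : PForm) : φ.toForm.Prov ↔ φ.Prov :=
  ⟨fun h => Form.toPForm_toForm φ ▸ h.toPForm, fun h => h.toForm⟩

namespace Form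

/-- The reading of a formula when each world is the only world accessible from itself: `⇝` becomes
material implication. -/
def toOForm : Form → OForm
  | var p => .var p
  | neg φ => .neg φ.toOForm
  | disj φ ψ => .disj φ.toOForm ψ.toOForm
  | cf φ ψ => .imp φ.toOForm ψ.toOForm
  | G φ => .G φ.toOForm
  | H φ => .H φ.toOForm
  | box φ => .box φ.toOForm

theorem toOForm_toForm (φ : OForm) : φ.toForm.toOForm = φ := by
  induction φ <;> simp_all [OForm.toForm, toOForm]

theorem occurs_toOForm {p : ℕ} {φ : Form} : OForm.Occurs p φ.toOForm ↔ Occurs p φ := by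
  induction φ <;> simp_all [Occurs, OForm.Occurs, toOForm, OForm.imp]

theorem Prov.toOForm {φ : Form} (h : φ.Prov) : φ.toOForm.Prov := by
  induction h with
  | taut φ t =>
    exact .taut _ fun v hn hd => t (fun a => v a.toOForm) (fun _ => hn _) (fun _ _ => hd _ _)
  | mp φ ψ _ _ h₁ h₂ => exact .mp _ _ h₁ h₂
  | rea φ ψ χ _ h | recq φ ψ χ _ h =>
    -- Material implication respects equivalents inside a tautology, so both congruence rules become
    -- modus ponens.
    refine .mp _ _ h (.taut _ fun v hn hd => ?_)
    simp only [Form.imp, Form.biimp, Form.conj, Form.toOForm, OForm.imp, hn, hd]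
    tauto
  | kG => exact .kG _ _
  | fourG => exact .fourG _
  | kH => exact .kH _ _
  | fourH => exact .fourH _
  | kBox => exact .kBox _ _
  | tBox => exact .tBox _
  | fiveBox => exact .fiveBox _
  | l1 => exact .l1 _
  | l1p => exact .l1p _
  | l2 => exact .l2 _
  | l2p => exact .l2p _
  | l3 => exact .l3 _
  | l4 => exact .l4 _
  | l5 => exact .l5 _
  | l6 => exact .l6 _
  | necBox φ _ h => exact .necBox _ h
  | necG φ _ h => exact .necG _ h
  | necH φ _ h => exact .necH _ h
  | irr p φ hp _ h => exact .irr p _ (fun h' => hp (occurs_toOForm.1 h')) h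
  | _ =>
    refine .taut _ fun v hn hd => ?_
    simp only [Form.imp, Form.conj, Form.toOForm, OForm.imp, hn, hd]
    tauto

/-- Every formula has a variable beyond all its variables. -/
theorem exists_bound_occurs (φ : Form) : ∃ n, ∀ p, Occurs p φ → p < n := by
  induction φ with
  | var q => exact ⟨q + 1, fun p (h : p = q) => by omega⟩
  | neg φ h | G φ h | H φ h | box φ h => exact h
  | disj φ ψ h₁ h₂ | cf φ ψ h₁ h₂ =>
    obtain ⟨n, hn⟩ := h₁
    obtain ⟨m, hm⟩ := h₂
    refine ⟨max n m, fun p h => ?_⟩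
    rcases h with h | h
    · exact lt_max_of_lt_left (hn p h)
    · exact lt_max_of_lt_right (hm p h)

end Form

namespace OForm

/-- Substitution of formulas of the joint language for the variables. -/
def subst (σ : ℕ → Form) : OForm → Form
  | var p => σ p
  | neg φ => .neg (subst σ φ)
  | disj φ ψ => .disj (subst σ φ) (subst σ ψ)
  | G φ => .G (subst σ φ)
  | H φ => .H (subst σ φ)
  | box φ => .box (subst σ φ)

theorem subst_update {p : ℕ} {φ : OForm} (h : ¬ Occurs p φ) (σ : ℕ → Form) (τ : Form) :
    φ.subst (Function.update σ p τ) = φ.subst σ := by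
  induction φ with
  | var q =>
    have : q ≠ p := fun e => h e.symm
    simp [subst, Function.update_of_ne this]
  | _ => simp_all [subst, Occurs]

theorem subst_var (φ : OForm) : φ.subst .var = φ.toForm := by
  induction φ <;> simp_all [subst, toForm]

/-- The induction is uniform in `σ` because of the irreflexivity rule: `σ` may bring `p` into `φ`,
so `p` itself is sent to a variable `q` fresh for the substituted formula. -/
theorem Prov.subst {φ : OForm} (h : φ.Prov) (σ : ℕ → Form) : (φ.subst σ).Prov := by
  induction h generalizing σ with
  | taut φ t =>
    exact .taut _ fun v hn hd => t (fun a => v (a.subst σ)) (fun _ => hn _) (fun _ _ => hd _ _)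
  | mp φ ψ _ _ h₁ h₂ => exact .mp _ _ (h₁ σ) (h₂ σ)
  | kG => exact .kG _ _
  | fourG => exact .fourG _
  | kH => exact .kH _ _
  | fourH => exact .fourH _
  | kBox => exact .kBox _ _
  | tBox => exact .tBox _
  | fiveBox => exact .fiveBox _
  | l1 => exact .l1 _
  | l1p => exact .l1p _
  | l2 => exact .l2 _
  | l2p => exact .l2p _
  | l3 => exact .l3 _
  | l4 => exact .l4 _
  | l5 => exact .l5 _
  | l6 => exact .l6 _
  | necBox φ _ h => exact .necBox _ (h σ)
  | necG φ _ h => exact .necG _ (h σ)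
  | necH φ _ h => exact .necH _ (h σ)
  | irr p φ hp _ h =>
    obtain ⟨q, hq⟩ := (φ.subst σ).exists_bound_occurs
    have h' := h (Function.update σ p (.var q))
    simp only [imp, conj, OForm.subst, Function.update_self, subst_update hp] at h'
    exact .irr q _ (fun ho => lt_irrefl q (hq q ho)) h'

theorem prov_toForm_iff (φ : OForm) : φ.toForm.Prov ↔ φ.Prov :=
  ⟨fun h => Form.toOForm_toForm φ ▸ h.toOForm, fun h => subst_var φ ▸ h.subst _⟩

end OForm

end PBT

namespace PBT

/-! ### Soundness -/

namespace BTFrame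

variable {F : BTFrame}

/-- By maximality of `h`: adjoining `x` gives a chain. -/
theorem mem_of_comparable {h : Set F.M} (hh : h ∈ F.histories) {x : F.M}
    (hx : ∀ k ∈ h, k ≠ x → F.earlier k x ∨ F.earlier x k) : x ∈ h := by
  have hc : IsChain F.earlier (insert x h) :=
    (F.maximal h hh).1.insert fun k hk hne => (hx k hk hne.symm).symm
  rw [(F.maximal h hh).2 hc (Set.subset_insert x h)]
  exact Set.mem_insert x h

/-- A member of `h` before `m` is comparable with `k` by backward linearity; any other member comes
after `k`. -/
theorem mem_of_earlier {h : Set F.M} (hh : h ∈ F.histories) {m k : F.M} (hm : m ∈ h)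
    (hk : F.earlier k m) : k ∈ h := by
  refine mem_of_comparable hh fun l hl hne => ?_
  by_cases hlm : l = m
  · exact .inr (hlm ▸ hk)
  rcases (F.maximal h hh).1 hl hm hlm with hlm | hlm
  · rcases F.backward_linear _ _ _ hlm hk with h | h | h
    exacts [.inr h, .inl h, absurd h hne]
  · exact .inr (F.trans _ _ _ hk hlm)

theorem Point.ext' {x y : F.Point} (hm : x.moment = y.moment) (hh : x.history = y.history) :
    x = y := by
  cases x; cases y; cases hm; cases hh; rfl

theorem pointEarlier_total {x y : F.Point} (hh : x.history = y.history) :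
    F.pointEarlier x y ∨ x = y ∨ F.pointEarlier y x := by
  by_cases hm : x.moment = y.moment
  · exact .inr (.inl (Point.ext' hm hh))
  rcases (F.maximal _ x.history_mem).1 x.moment_mem (hh ▸ y.moment_mem) hm with h | h
  exacts [.inl ⟨hh, h⟩, .inr (.inr ⟨hh.symm, h⟩)]

end BTFrame

namespace Frame

variable (F : Frame)

theorem earlier_irrefl (x : F.W) : ¬ F.earlier x x := by
  obtain ⟨B, e, he, -⟩ := F.branching
  exact fun h => B.irrefl _ ((he _ _).1 h).2

theorem earlier_trans {x y z : F.W} (h : F.earlier x y) (h' : F.earlier y z) : F.earlier x z := by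
  obtain ⟨B, e, he, -⟩ := F.branching
  rw [he] at *
  exact ⟨h.1.trans h'.1, B.trans _ _ _ h.2 h'.2⟩

theorem earlier_total_of_left {x y z : F.W} (h : F.earlier x y) (h' : F.earlier x z) :
    F.earlier y z ∨ y = z ∨ F.earlier z y := by
  obtain ⟨B, e, he, -⟩ := F.branching
  rw [he] at *
  rw [he, ← e.apply_eq_iff_eq]
  exact BTFrame.pointEarlier_total (h.1.symm.trans h'.1)

theorem earlier_total_of_right {x y z : F.W} (h : F.earlier y x) (h' : F.earlier z x) :
    F.earlier y z ∨ y = z ∨ F.earlier z y := by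
  obtain ⟨B, e, he, -⟩ := F.branching
  rw [he] at *
  rw [he, ← e.apply_eq_iff_eq]
  exact BTFrame.pointEarlier_total (h.1.trans h'.1.symm)

theorem rBox_refl (x : F.W) : F.rBox x x := by
  obtain ⟨B, e, -, hr⟩ := F.branching
  exact (hr _ _).2 rfl

theorem rBox_symm {x y : F.W} (h : F.rBox x y) : F.rBox y x := by
  obtain ⟨B, e, -, hr⟩ := F.branching
  rw [hr] at *
  exact h.symm

theorem rBox_trans {x y z : F.W} (h : F.rBox x y) (h' : F.rBox y z) : F.rBox x z := by
  obtain ⟨B, e, -, hr⟩ := F.branching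
  rw [hr] at *
  exact h.trans h'

/-- Worlds at the same moment share their past moments. -/
theorem exists_earlier_of_rBox {x y z : F.W} (h : F.rBox x y) (hz : F.earlier z x) :
    ∃ z', F.earlier z' y ∧ F.rBox z z' := by
  obtain ⟨B, e, he, hr⟩ := F.branching
  rw [hr] at h
  rw [he] at hz
  have hm : B.earlier (e z).moment (e y).moment := h ▸ hz.2
  refine ⟨e.symm ⟨(e z).moment, (e y).history, (e y).history_mem,
    BTFrame.mem_of_earlier (e y).history_mem (e y).moment_mem hm⟩, ?_, ?_⟩
  · rw [he, e.apply_symm_apply]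
    exact ⟨rfl, hm⟩
  · rw [hr, e.apply_symm_apply]
    rfl

/-- A moment that is last in one history is last in every history. -/
theorem exists_later_of_rBox {x y z : F.W} (h : F.rBox x y) (hz : F.earlier y z) :
    ∃ z', F.earlier x z' := by
  obtain ⟨B, e, he, hr⟩ := F.branching
  rw [hr] at h
  rw [he] at hz
  by_contra! hno
  have hlast : ∀ k ∈ (e x).history, ¬ B.earlier (e x).moment k := fun k hk hlt =>
    hno (e.symm ⟨k, (e x).history, (e x).history_mem, hk⟩)
      (by rw [he, e.apply_symm_apply]; exact ⟨rfl, hlt⟩)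
  have hm : B.earlier (e x).moment (e z).moment := h.symm ▸ hz.2
  -- If `x` were last, the moment of `z` would lie after all of its history, hence belong to that
  -- history by maximality.
  refine hlast _ (BTFrame.mem_of_comparable (e x).history_mem fun k hk _ => .inl ?_) hm
  by_cases hkx : k = (e x).moment
  · exact hkx ▸ hm
  · rcases (B.maximal _ (e x).history_mem).1 hk (e x).moment_mem hkx with hlt | hlt
    exacts [B.trans _ _ _ hlt hm, absurd hlt (hlast k hk)]

variable {F}

theorem sat_conj {V : ℕ → Set F.W} {w : F.W} {φ ψ : Form} :
    F.Sat V w (φ.conj ψ) ↔ F.Sat V w φ ∧ F.Sat V w ψ := by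
  simp only [Form.conj, Sat]; tauto

theorem sat_imp {V : ℕ → Set F.W} {w : F.W} {φ ψ : Form} :
    F.Sat V w (φ.imp ψ) ↔ (F.Sat V w φ → F.Sat V w ψ) := by
  simp only [Form.imp, Sat]; tauto

theorem sat_biimp {V : ℕ → Set F.W} {w : F.W} {φ ψ : Form} :
    F.Sat V w (φ.biimp ψ) ↔ (F.Sat V w φ ↔ F.Sat V w ψ) := by
  simp only [Form.biimp, sat_conj, sat_imp]; tauto

theorem sat_F {V : ℕ → Set F.W} {w : F.W} {φ : Form} :
    F.Sat V w φ.F ↔ ∃ v, F.earlier w v ∧ F.Sat V v φ := by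
  simp [Form.F, Sat]

theorem sat_P {V : ℕ → Set F.W} {w : F.W} {φ : Form} :
    F.Sat V w φ.P ↔ ∃ v, F.earlier v w ∧ F.Sat V v φ := by
  simp [Form.P, Sat]

theorem sat_dia {V : ℕ → Set F.W} {w : F.W} {φ : Form} :
    F.Sat V w φ.dia ↔ ∃ v, F.rBox w v ∧ F.Sat V v φ := by
  simp [Form.dia, Sat]

theorem sat_congr_of_not_occurs {p : ℕ} {φ : Form} (h : ¬ φ.Occurs p) {V V' : ℕ → Set F.W}
    (hV : ∀ q, q ≠ p → V q = V' q) (w : F.W) : F.Sat V w φ ↔ F.Sat V' w φ := by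
  induction φ generalizing w with
  | var q => simp only [Sat, hV q fun e => h e.symm]
  | _ => simp_all [Sat, Form.Occurs]

end Frame

theorem Form.Prov.valid {φ : Form} (h : φ.Prov) : φ.Valid := by
  induction h with
  | taut φ t => exact fun F V w => t (F.Sat V w) (fun _ => Iff.rfl) (fun _ _ => Iff.rfl)
  | mp φ ψ _ _ h₁ h₂ => exact fun F V w => Frame.sat_imp.1 (h₂ F V w) (h₁ F V w)
  | ci φ => exact fun F V w v _ h _ => h
  | cc φ ψ χ =>
    intro F V w
    simp only [Frame.sat_imp, Frame.sat_conj, Frame.Sat]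
    exact fun h v h₁ h₂ h₃ => ⟨h.1 v h₁ h₂ h₃, h.2 v h₁ h₂ h₃⟩
  | cw φ ψ χ =>
    intro F V w
    simp only [Frame.sat_imp, Frame.Sat]
    exact fun h v h₁ h₂ h₃ => .inl (h v h₁ h₂ h₃)
  | sa φ ψ χ =>
    intro F V w
    simp only [Frame.sat_imp, Frame.sat_conj, Frame.Sat]
    rintro ⟨h, h'⟩ v hv ⟨hφ, hψ⟩ hmin
    refine h' v hv hφ fun u hu huφ huv => ?_
    -- A `φ`-world `u` closer than `v` need not satisfy `ψ`, but a closest `φ`-world `y` at or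
    -- before `u` does, and it contradicts the minimality of `v` among the `φ ∧ ψ`-worlds.
    obtain ⟨y, ⟨hy, hyφ⟩, hyu, hymin⟩ :=
      F.limit w {x | x ∈ F.acc w ∧ F.Sat V x φ} (fun x hx => hx.1) u ⟨hu, huφ⟩
    have hyv : F.closer w y v := by
      rcases hyu with rfl | hyu
      exacts [huv, F.closer_trans _ _ _ _ hyu huv]
    exact hmin y hy ⟨hyφ, h y hy hyφ fun z hz hzφ => hymin z ⟨hz, hzφ⟩⟩ hyv
  | ad φ ψ χ =>
    intro F V w
    simp only [Frame.sat_imp, Frame.sat_conj, Frame.Sat]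
    rintro ⟨h, h'⟩ v hv hφψ hmin
    rcases hφψ with hφ | hψ
    · exact h v hv hφ fun u hu huφ => hmin u hu (.inl huφ)
    · exact h' v hv hψ fun u hu huψ => hmin u hu (.inr huψ)
  | rea φ ψ χ _ h =>
    intro F V w
    have h' := fun v => Frame.sat_biimp.1 (h F V v)
    simp only [Frame.sat_biimp, Frame.Sat, h']
  | recq φ ψ χ _ h =>
    intro F V w
    have h' := fun v => Frame.sat_biimp.1 (h F V v)
    simp only [Frame.sat_biimp, Frame.Sat, h']
  | kG | kH | kBox =>
    intro F V w
    simp only [Frame.sat_imp, Frame.Sat]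
    exact fun h h' v hv => h v hv (h' v hv)
  | fourG φ =>
    intro F V w
    simp only [Frame.sat_imp, Frame.Sat]
    exact fun h v hv u hu => h u (F.earlier_trans hv hu)
  | fourH φ =>
    intro F V w
    simp only [Frame.sat_imp, Frame.Sat]
    exact fun h v hv u hu => h u (F.earlier_trans hu hv)
  | tBox φ =>
    intro F V w
    simp only [Frame.sat_imp, Frame.Sat]
    exact fun h => h w (F.rBox_refl w)
  | fiveBox φ =>
    intro F V w
    simp only [Frame.sat_imp, Frame.sat_dia, Frame.Sat]
    exact fun ⟨v, hv, h⟩ u hu => ⟨v, F.rBox_trans (F.rBox_symm hu) hv, h⟩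
  | l1 φ =>
    intro F V w
    simp only [Frame.sat_imp, Frame.sat_P, Frame.Sat]
    exact fun h v hv => ⟨w, hv, h⟩
  | l1p φ =>
    intro F V w
    simp only [Frame.sat_imp, Frame.sat_F, Frame.Sat]
    exact fun h v hv => ⟨w, hv, h⟩
  | l2 φ =>
    intro F V w
    simp only [Frame.sat_imp, Frame.sat_F, Frame.sat_P, Frame.Sat]
    rintro ⟨v, hv, h⟩ u hu
    rcases F.earlier_total_of_left hv hu with hvu | rfl | hvu
    exacts [.inr (.inr ⟨v, hvu, h⟩), .inr (.inl h), .inl ⟨v, hvu, h⟩]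
  | l2p φ =>
    intro F V w
    simp only [Frame.sat_imp, Frame.sat_F, Frame.sat_P, Frame.Sat]
    rintro ⟨v, hv, h⟩ u hu
    rcases F.earlier_total_of_right hv hu with hvu | rfl | hvu
    exacts [.inl ⟨v, hvu, h⟩, .inr (.inl h), .inr (.inr ⟨v, hvu, h⟩)]
  | l3 φ =>
    intro F V w
    simp only [Frame.sat_imp, Frame.Sat]
    intro h v hv u hu
    obtain ⟨u', hu', hr⟩ := F.exists_earlier_of_rBox (F.rBox_symm hv) hu
    exact h u' hu' u (F.rBox_symm hr)
  | l4 φ =>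
    intro F V w
    simp only [Frame.sat_imp, Frame.sat_P, Frame.Sat]
    rintro ⟨u, hu, h⟩ v hv
    obtain ⟨u', hu', hr⟩ := F.exists_earlier_of_rBox hv hu
    exact ⟨u', hu', h u' hr⟩
  | l5 φ =>
    intro F V w
    simp only [Frame.sat_imp, Frame.Sat]
    intro h v hv u hu
    obtain ⟨w', hw', hr⟩ := F.exists_earlier_of_rBox hu hv
    exact h w' hr u hw'
  | l6 φ =>
    intro F V w
    simp only [Frame.sat_imp, Frame.sat_conj, Frame.Sat]
    intro h v hv u hu
    obtain ⟨u', hu'⟩ := F.exists_later_of_rBox hv hu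
    exact absurd (h u' hu').1 (h u' hu').2
  | necBox φ _ h | necG φ _ h | necH φ _ h => exact fun F V w v _ => h F V v
  | irr p φ hp _ h =>
    intro F V w
    -- With `p` true at `w` alone, irreflexivity makes `p ∧ H ¬p` true at `w`.
    have h' := h F (Function.update V p {w}) w
    rw [Frame.sat_imp, Frame.sat_conj] at h'
    refine (Frame.sat_congr_of_not_occurs hp (fun q hq => Function.update_of_ne hq _ _) w).1
      (h' ⟨?_, fun v hv hvp => ?_⟩)
    · simp [Frame.Sat]
    · simp only [Frame.Sat, Function.update_self, Set.mem_singleton_iff] at hvp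
      exact F.earlier_irrefl w (hvp ▸ hv)

end PBT

namespace PBT

/-! ### Maximal consistent sets -/

namespace Form

/-- Assignments of truth values to all formulas that respect `¬` and `∨`. -/
structure IsBoolean (v : Form → Prop) : Prop where
  neg : ∀ a, v (neg a) ↔ ¬ v a
  disj : ∀ a b, v (disj a b) ↔ (v a ∨ v b)

/-- Maximal consistent sets: Boolean assignments that make every theorem true. -/
structure IsMaxCons (v : Form → Prop) : Prop extends IsBoolean v where
  of_prov : ∀ φ, Prov φ → v φ

theorem IsBoolean.imp {v : Form → Prop} (h : IsBoolean v) (a b : Form) :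
    v (a.imp b) ↔ (v a → v b) := by
  simp only [Form.imp, h.neg, h.disj]; tauto

theorem IsBoolean.conj {v : Form → Prop} (h : IsBoolean v) (a b : Form) :
    v (a.conj b) ↔ (v a ∧ v b) := by
  simp only [Form.conj, h.neg, h.disj]; tauto

theorem IsBoolean.biimp {v : Form → Prop} (h : IsBoolean v) (a b : Form) :
    v (a.biimp b) ↔ (v a ↔ v b) := by
  simp only [Form.biimp, h.imp, h.conj]; tauto

/-- An injective numbering of the formulas. -/
def code : Form → ℕ
  | var p => Nat.pair 0 p
  | neg φ => Nat.pair 1 φ.code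
  | disj φ ψ => Nat.pair 2 (Nat.pair φ.code ψ.code)
  | cf φ ψ => Nat.pair 3 (Nat.pair φ.code ψ.code)
  | G φ => Nat.pair 4 φ.code
  | H φ => Nat.pair 5 φ.code
  | box φ => Nat.pair 6 φ.code

theorem code_injective : Function.Injective code := by
  intro φ ψ h
  induction φ generalizing ψ <;> cases ψ <;> simp [code, Nat.pair_eq_pair] at h ⊢
  all_goals grind

/-- The formula with a given number. -/
noncomputable def decode : ℕ → Form :=
  have : Nonempty Form := ⟨var 0⟩
  Function.invFun code

theorem decode_code (φ : Form) : decode φ.code = φ :=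
  have : Nonempty Form := ⟨var 0⟩
  Function.leftInverse_invFun code_injective φ

open Classical in
/-- The conjunction of `θ` with those of the first `n` formulas that are consistent with
what precedes. -/
noncomputable def lindenbaum (θ : Form) : ℕ → Form
  | 0 => θ
  | n + 1 => if Prov (imp (lindenbaum θ n) (neg (decode n))) then lindenbaum θ n
      else conj (lindenbaum θ n) (decode n)

theorem lindenbaum_consistent {θ : Form} (h : ¬ Prov (neg θ)) (n : ℕ) :
    ¬ Prov (neg (lindenbaum θ n)) := by
  induction n with
  | zero => exact h
  | succ n ih =>
    rw [lindenbaum]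
    split_ifs with hn
    · exact ih
    · refine fun hp => hn (hp.mono_taut fun v hn hd => ?_)
      simp only [imp, conj, hn, hd]; tauto

theorem lindenbaum_antitone (θ : Form) {m n : ℕ} (h : m ≤ n) :
    Prov (imp (lindenbaum θ n) (lindenbaum θ m)) := by
  induction n, h using Nat.le_induction with
  | base =>
    refine .taut _ fun v hn hd => ?_
    simp only [imp, hn, hd]; tauto
  | succ n _ ih =>
    rw [lindenbaum]
    split_ifs
    · exact ih
    · refine ih.mono_taut fun v hn hd => ?_
      simp only [imp, conj, hn, hd]; tauto

/-- The set consists of the consequences of the stages of `lindenbaum`. Stages grow in strength, so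
any two members follow from a common stage, and `a` is decided at stage `a.code`. -/
theorem exists_isMaxCons {θ : Form} (h : ¬ Prov (neg θ)) : ∃ v, IsMaxCons v ∧ v θ := by
  set v : Form → Prop := fun φ => ∃ n, Prov (imp (lindenbaum θ n) φ) with hv
  have mp₂ : ∀ {a b c}, v a → v b → Taut (imp a (imp b c)) → v c := by
    rintro a b c ⟨m, hm⟩ ⟨n, hn⟩ t
    refine ⟨max m n, ?_⟩
    have h₁ := (lindenbaum_antitone θ (le_max_left m n)).mono_taut₂
      (χ := imp (lindenbaum θ (max m n)) a) hm fun v hn hd => by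
        simp only [imp, hn, hd]; tauto
    have h₂ := (lindenbaum_antitone θ (le_max_right m n)).mono_taut₂
      (χ := imp (lindenbaum θ (max m n)) b) hn fun v hn hd => by
        simp only [imp, hn, hd]; tauto
    refine h₁.mono_taut₂ h₂ fun v hn hd => ?_
    have := t v hn hd
    simp only [imp, hn, hd] at this ⊢; tauto
  have of_prov : ∀ φ, Prov φ → v φ := fun φ hφ => ⟨0, hφ.mono_taut fun v hn hd => by
    simp only [imp, hn, hd]; tauto⟩
  have em : ∀ a, v a ∨ v (neg a) := by
    intro a
    by_cases ha : Prov (imp (lindenbaum θ a.code) (neg a))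
    · exact .inr ⟨_, ha⟩
    · refine .inl ⟨a.code + 1, ?_⟩
      rw [lindenbaum, decode_code, if_neg ha]
      refine .taut _ fun v hn hd => ?_
      simp only [imp, conj, hn, hd]; tauto
  have cons : ∀ a, v a → v (neg a) → False := by
    intro a ha hna
    obtain ⟨n, hn⟩ := mp₂ (c := neg θ) ha hna fun v hn hd => by
      simp only [imp, hn, hd]; tauto
    refine lindenbaum_consistent h n ((lindenbaum_antitone θ n.zero_le).mono_taut₂ hn
      fun v hn hd => ?_)
    simp only [imp, lindenbaum, hn, hd]; tauto
  have neg_iff : ∀ a, v (neg a) ↔ ¬ v a :=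
    fun a => ⟨fun h h' => cons a h' h, (em a).resolve_left⟩
  refine ⟨v, ⟨⟨neg_iff, fun a b => ⟨fun hab => ?_, fun hab => ?_⟩⟩, of_prov⟩, 0, ?_⟩
  · by_contra! hno
    have hna := (neg_iff a).2 hno.1
    refine hno.2 (mp₂ hab hna fun v hn hd => ?_)
    simp only [imp, hn, hd]; tauto
  · rcases hab with hab | hab
    all_goals
      refine mp₂ hab hab fun v hn hd => ?_
      simp only [imp, hn, hd]; tauto
  · refine .taut _ fun v hn hd => ?_
    simp only [imp, lindenbaum, hn, hd]; tauto

theorem prov_iff_forall_isMaxCons {φ : Form} : Prov φ ↔ ∀ v, IsMaxCons v → v φ := by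
  refine ⟨fun h v hv => hv.of_prov φ h, fun h => ?_⟩
  by_contra hφ
  obtain ⟨v, hv, hvφ⟩ := exists_isMaxCons (θ := neg φ) fun hp => hφ (hp.mono_taut fun v hn hd => by
    simp only [imp, hn, hd]; tauto)
  exact (hv.neg φ).1 hvφ (h v hv)

/-- The nesting depth of `⇝`. -/
def cfDepth : Form → ℕ
  | var _ => 0
  | neg φ => φ.cfDepth
  | disj φ ψ => max φ.cfDepth ψ.cfDepth
  | cf φ ψ => max φ.cfDepth ψ.cfDepth + 1
  | G φ => φ.cfDepth
  | H φ => φ.cfDepth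
  | box φ => φ.cfDepth

open Classical in
/-- Every condition on the truth values of finitely many formulas is expressed by a formula. -/
theorem exists_definition (Δ : List Form) {k : ℕ} (hΔ : ∀ δ ∈ Δ, δ.cfDepth ≤ k)
    (A : (Form → Prop) → Prop)
    (hA : ∀ v v', (∀ δ ∈ Δ, v δ ↔ v' δ) → A v → A v') :
    ∃ a : Form, a.cfDepth ≤ k ∧ ∀ v, IsBoolean v → (v a ↔ A v) := by
  induction Δ generalizing A with
  | nil =>
    have key : ∀ v v', A v ↔ A v' := fun v v' => ⟨hA _ _ (by simp), hA _ _ (by simp)⟩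
    by_cases h : A fun _ => True
    · refine ⟨disj (var 0) (neg (var 0)), by simp [cfDepth], fun v hv => ?_⟩
      rw [hv.disj, hv.neg]
      exact iff_of_true (Classical.em _) ((key _ _).1 h)
    · refine ⟨conj (var 0) (neg (var 0)), by simp [cfDepth, conj], fun v hv => ?_⟩
      rw [hv.conj, hv.neg]
      exact iff_of_false (by tauto) fun h' => h ((key _ _).1 h')
  | cons δ Δ ih =>
    -- Case distinction on the value of `δ`: overriding it by a fixed `P` leaves a condition that
    -- depends on `Δ` only.
    have hdep : ∀ P : Prop, ∀ v v' : Form → Prop, (∀ δ ∈ Δ, v δ ↔ v' δ) →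
        A (Function.update v δ P) → A (Function.update v' δ P) := fun P v v' hv => by
      refine hA _ _ fun ε hε => ?_
      by_cases he : ε = δ
      · subst he; simp
      · simpa [Function.update_of_ne he] using hv ε ((List.mem_cons.1 hε).resolve_left he)
    have hk : ∀ δ ∈ Δ, δ.cfDepth ≤ k := fun ε hε => hΔ ε (List.mem_cons_of_mem _ hε)
    have hδ := hΔ δ List.mem_cons_self
    obtain ⟨a, ha, ha'⟩ := ih hk _ (hdep True)
    obtain ⟨b, hb, hb'⟩ := ih hk _ (hdep False)
    refine ⟨disj (conj δ a) (conj (neg δ) b), by simp [cfDepth, conj, *], fun v hv => ?_⟩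
    rw [hv.disj, hv.conj, hv.conj, hv.neg, ha' v hv, hb' v hv]
    by_cases hvδ : v δ
    · have : Function.update v δ True = v := by
        rw [← Function.update_eq_self δ v]; simp [hvδ]
      simp [hvδ, this]
    · have : Function.update v δ False = v := by
        rw [← Function.update_eq_self δ v]; simp [hvδ]
      simp [hvδ, this]

end Form

/-! ### Preferential models of choice functions -/

section Choice

variable {U : Type} (f : Set U → Set U)

/-- Choice functions of preferential reasoning. -/
structure IsPreferential : Prop where
  subset : ∀ A, f A ⊆ A
  union : ∀ A B, f (A ∪ B) ⊆ f A ∪ f B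
  cautious : ∀ A B, f A ⊆ B → f (A ∩ B) ⊆ f A

variable {f}

/-- Split `A` into `B` and `A \ B`; a chosen element in `B` cannot come from `f (A \ B)`. -/
theorem IsPreferential.inter_subset (hf : IsPreferential f) {A B : Set U} (h : B ⊆ A) :
    f A ∩ B ⊆ f B := by
  rintro x ⟨hx, hxB⟩
  have hA : A = B ∪ A \ B := by rw [Set.union_sdiff_cancel h]
  rw [hA] at hx
  rcases hf.union _ _ hx with h | h
  · exact h
  · exact absurd hxB (hf.subset _ h).2

theorem IsPreferential.cumulative (hf : IsPreferential f) {A B : Set U} (h : f A ⊆ B)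
    (hBA : B ⊆ A) : f A = f B := by
  refine Set.Subset.antisymm (fun x hx => hf.inter_subset hBA ⟨hx, h hx⟩) ?_
  have := hf.cautious A B h
  rwa [Set.inter_eq_right.2 hBA] at this

/-- The states of the preferential model of a choice function. -/
abbrev PrefState (f : Set U → Set U) : Type := {s : U × Set U // s.1 ∈ f s.2}

/-- The preference between states. -/
def PrefState.lt (s t : PrefState f) : Prop :=
  f (s.1.2 ∪ t.1.2) ⊆ s.1.2 ∧ s.1.1 ∉ t.1.2

theorem PrefState.lt_irrefl (hf : IsPreferential f) (s : PrefState f) : ¬ s.lt s :=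
  fun h => h.2 (hf.subset _ s.2)

/-- For states `(m, A)`, `(n, B)`, `(k, C)`, cumulativity makes `f` agree on `A ∪ B ∪ C`, `A ∪ B`,
`A` and `A ∪ C`. If `m` were in `C`, it would lie in `f (B ∪ C) ⊆ B`, against the first comparison.
-/
theorem PrefState.lt_trans (hf : IsPreferential f) {s t u : PrefState f} (h : s.lt t)
    (h' : t.lt u) : s.lt u := by
  obtain ⟨⟨m, A⟩, hm⟩ := s
  obtain ⟨⟨n, B⟩, hn⟩ := t
  obtain ⟨⟨k, C⟩, hk⟩ := u
  simp only [PrefState.lt] at *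
  have h₁ : f (A ∪ B ∪ C) ⊆ A ∪ B := by
    rw [Set.union_assoc]
    refine (hf.union _ _).trans (Set.union_subset_union (hf.subset _) h'.1)
  have h₂ : f (A ∪ B ∪ C) = f (A ∪ B) := hf.cumulative h₁ Set.subset_union_left
  have h₃ : f (A ∪ B) = f A := hf.cumulative h.1 Set.subset_union_left
  have hAC : A ∪ C ⊆ A ∪ B ∪ C := Set.union_subset_union_left _ Set.subset_union_left
  have h₄ : f (A ∪ B ∪ C) = f (A ∪ C) :=
    hf.cumulative (h₂ ▸ h.1.trans Set.subset_union_left) hAC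
  refine ⟨h₄ ▸ h₂ ▸ h.1, fun hmC => h.2 ?_⟩
  have hm' : m ∈ f (A ∪ B ∪ C) := by rw [h₂, h₃]; exact hm
  exact h'.1 (hf.inter_subset (by rw [Set.union_assoc]; exact Set.subset_union_right)
    ⟨hm', .inr hmC⟩)

/-- The choice function picks the labels of the most preferred states. -/
theorem PrefState.subset_iff (hf : IsPreferential f) (A B : Set U) :
    f A ⊆ B ↔ ∀ s : PrefState f, s.1.1 ∈ A → (∀ t : PrefState f, t.1.1 ∈ A → ¬ t.lt s) →
      s.1.1 ∈ B := by
  refine ⟨fun h s hs hmin => h ?_, fun h m hm => ?_⟩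
  · obtain ⟨⟨m, C⟩, hm⟩ := s
    have hsub : f (A ∪ C) ⊆ C := by
      intro k hk
      by_contra hkC
      have hkA : k ∈ A := (hf.subset _ hk).resolve_right hkC
      -- A chosen `k` outside `C` gives an `A`-state preferred to `(m, C)`.
      refine hmin ⟨(k, A ∪ C), hk⟩ hkA ⟨?_, hkC⟩
      change f (A ∪ C ∪ C) ⊆ A ∪ C
      rw [Set.union_assoc, Set.union_self]
      exact hf.subset _
    have hm' : m ∈ f (A ∪ C) := by
      rw [hf.cumulative hsub Set.subset_union_right]; exact hm
    exact hf.inter_subset Set.subset_union_left ⟨hm', hs⟩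
  · exact h ⟨(m, A), hm⟩ (hf.subset _ hm) fun t ht hlt => hlt.2 ht

end Choice

/-! ### Finite preferential models of maximal consistent sets -/

namespace Form

instance finite_mem (Δ : List Form) : Finite {δ // δ ∈ Δ} := List.finite_toSet Δ

/-- The formula `a` expresses, within maximal consistent sets, that the truth values of the formulas
in `Δ` belong to `A`. -/
def Defines (Δ : List Form) (a : Form) (A : Set ({δ // δ ∈ Δ} → Prop)) : Prop :=
  ∀ v, IsMaxCons v → (v a ↔ (fun δ => v δ.1) ∈ A)

theorem exists_defines (Δ : List Form) (A : Set ({δ // δ ∈ Δ} → Prop)) :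
    ∃ a, Defines Δ a A := by
  obtain ⟨k, hk⟩ : ∃ k, ∀ δ ∈ Δ, δ.cfDepth ≤ k := by
    refine ⟨(Δ.map cfDepth).sum, fun δ hδ => List.single_le_sum (by simp) _ ?_⟩
    exact List.mem_map_of_mem hδ
  obtain ⟨a, -, ha⟩ := exists_definition Δ hk (fun v => (fun δ : {δ // δ ∈ Δ} => v δ.1) ∈ A)
    fun v v' h hv => by
      have : (fun δ : {δ // δ ∈ Δ} => v δ.1) = fun δ => v' δ.1 := funext fun δ =>
        propext (h δ.1 δ.2)
      exact this ▸ hv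
  exact ⟨a, fun v hv => ha v hv.toIsBoolean⟩

/-- The conditional on conditions that a maximal consistent set induces. -/
def Entails (v : Form → Prop) (Δ : List Form) (A B : Set ({δ // δ ∈ Δ} → Prop)) : Prop :=
  ∃ a b, Defines Δ a A ∧ Defines Δ b B ∧ v (cf a b)

variable {v : Form → Prop} {Δ : List Form} {A B C : Set ({δ // δ ∈ Δ} → Prop)}

theorem Defines.prov_biimp {a a' : Form} (h : Defines Δ a A) (h' : Defines Δ a' A) :
    Prov (biimp a a') :=
  prov_iff_forall_isMaxCons.2 fun u hu => by rw [hu.biimp, h u hu, h' u hu]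

/-- Formulas defining the same condition are provably equivalent, so the two congruence rules make
the choice of `a` and `b` irrelevant. -/
theorem Entails.iff (hv : IsMaxCons v) {a b : Form} (ha : Defines Δ a A) (hb : Defines Δ b B) :
    Entails v Δ A B ↔ v (cf a b) := by
  refine ⟨fun ⟨a', b', ha', hb', h⟩ => ?_, fun h => ⟨a, b, ha, hb, h⟩⟩
  have h₁ := hv.of_prov _ (.rea _ _ b' (ha.prov_biimp ha'))
  have h₂ := hv.of_prov _ (.recq _ _ a (hb.prov_biimp hb'))
  rw [hv.biimp] at h₁ h₂
  exact h₂.2 (h₁.2 h)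

theorem Entails.refl (hv : IsMaxCons v) (A : Set ({δ // δ ∈ Δ} → Prop)) : Entails v Δ A A := by
  obtain ⟨a, ha⟩ := exists_defines Δ A
  exact ⟨a, a, ha, ha, hv.of_prov _ (.ci a)⟩

theorem Entails.mono (hv : IsMaxCons v) (h : Entails v Δ A B) (hBC : B ⊆ C) :
    Entails v Δ A C := by
  obtain ⟨a, b, ha, hb, hab⟩ := h
  obtain ⟨c, hc⟩ := exists_defines Δ C
  -- As `B ⊆ C`, the disjunction also defines `C`.
  refine ⟨a, disj b c, ha, fun u hu => ?_, ((hv.imp _ _).1 (hv.of_prov _ (.cw a b c))) hab⟩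
  rw [hu.disj, hb u hu, hc u hu]
  exact ⟨fun h => h.elim (fun h => hBC h) id, .inr⟩

theorem Entails.inter (hv : IsMaxCons v) (h : Entails v Δ A B) (h' : Entails v Δ A C) :
    Entails v Δ A (B ∩ C) := by
  obtain ⟨a, b, ha, hb, hab⟩ := h
  obtain ⟨c, hc⟩ := exists_defines Δ C
  rw [Entails.iff hv ha hc] at h'
  refine ⟨a, conj b c, ha, fun u hu => ?_, ?_⟩
  · rw [hu.conj, hb u hu, hc u hu, Set.mem_inter_iff]
  · have := hv.of_prov _ (.cc a b c)
    rw [hv.imp, hv.conj] at this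
    exact this ⟨hab, h'⟩

theorem Entails.cautious (hv : IsMaxCons v) (h : Entails v Δ A B) (h' : Entails v Δ A C) :
    Entails v Δ (A ∩ B) C := by
  obtain ⟨a, b, ha, hb, hab⟩ := h
  obtain ⟨c, hc⟩ := exists_defines Δ C
  rw [Entails.iff hv ha hc] at h'
  refine ⟨conj a b, c, fun u hu => ?_, hc, ?_⟩
  · rw [hu.conj, ha u hu, hb u hu, Set.mem_inter_iff]
  · have := hv.of_prov _ (.sa a b c)
    rw [hv.imp, hv.conj] at this
    exact this ⟨hab, h'⟩

theorem Entails.union (hv : IsMaxCons v) (h : Entails v Δ A C) (h' : Entails v Δ B C) :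
    Entails v Δ (A ∪ B) C := by
  obtain ⟨a, c, ha, hc, hac⟩ := h
  obtain ⟨b, hb⟩ := exists_defines Δ B
  rw [Entails.iff hv hb hc] at h'
  refine ⟨disj a b, c, fun u hu => ?_, hc, ?_⟩
  · rw [hu.disj, ha u hu, hb u hu, Set.mem_union]
  · have := hv.of_prov _ (.ad a b c)
    rw [hv.imp, hv.conj] at this
    exact this ⟨hac, h'⟩

/-- The strongest condition entailed by a condition. -/
def core (v : Form → Prop) (Δ : List Form) (A : Set ({δ // δ ∈ Δ} → Prop)) :
    Set ({δ // δ ∈ Δ} → Prop) :=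
  ⋂₀ {B | Entails v Δ A B}

theorem entails_iff_core_subset (hv : IsMaxCons v) : Entails v Δ A B ↔ core v Δ A ⊆ B := by
  refine ⟨fun h => Set.sInter_subset_of_mem h, fun h => Entails.mono hv ?_ h⟩
  -- There are finitely many conditions on `Δ`, so finitely many uses of CC reach the core itself.
  have key : ∀ 𝓑 : Set (Set ({δ // δ ∈ Δ} → Prop)), 𝓑.Finite → (∀ B ∈ 𝓑, Entails v Δ A B) →
      Entails v Δ A (⋂₀ 𝓑) := by
    intro 𝓑 hfin
    induction 𝓑, hfin using Set.Finite.induction_on with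
    | empty => exact fun _ => (Entails.refl hv A).mono hv (by simp)
    | insert _ _ ih =>
      intro h
      rw [Set.sInter_insert]
      exact (h _ (Set.mem_insert _ _)).inter hv (ih fun B hB => h B (Set.mem_insert_of_mem _ hB))
  exact key _ (Set.toFinite _) fun B hB => hB

/-- Inclusion comes from CI, the union law from AD and cautious monotony from SA. -/
theorem isPreferential_core (hv : IsMaxCons v) : IsPreferential (core v Δ) where
  subset _ := (entails_iff_core_subset hv).1 (Entails.refl hv _)
  union _ _ := (entails_iff_core_subset hv).1
    (((entails_iff_core_subset hv).2 Set.subset_union_left).union hv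
      ((entails_iff_core_subset hv).2 Set.subset_union_right))
  cautious _ _ h := (entails_iff_core_subset hv).1
    (((entails_iff_core_subset hv).2 h).cautious hv
      ((entails_iff_core_subset hv).2 subset_rfl))

/-- If no maximal consistent set realises `t`, a formula defining `A` also defines `A \ {t}`; CI
then removes `t` from the core. -/
theorem exists_isMaxCons_of_mem_core (hv : IsMaxCons v) {t : {δ // δ ∈ Δ} → Prop}
    (ht : t ∈ core v Δ A) : ∃ u, IsMaxCons u ∧ ∀ δ, u δ.1 ↔ t δ := by
  by_contra! hno
  obtain ⟨a, ha⟩ := exists_defines Δ A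
  have hA : Entails v Δ A (A \ {t}) := by
    refine ⟨a, a, ha, fun u hu => ?_, hv.of_prov _ (.ci a)⟩
    rw [ha u hu, Set.mem_sdiff, Set.mem_singleton_iff]
    refine ⟨fun h => ⟨h, fun he => ?_⟩, fun h => h.1⟩
    obtain ⟨δ, hδ⟩ := hno u hu
    have := congrFun he δ
    simp_all
  exact ((entails_iff_core_subset hv).1 hA ht).2 rfl

/-- The counterfactuals in a maximal consistent set that are built from finitely many formulas are
those true in some finite preferential model. -/
theorem IsMaxCons.exists_preferential (hv : IsMaxCons v) (Δ : List Form) :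
    ∃ (S : Type) (_ : Finite S) (lt : S → S → Prop) (label : S → Form → Prop),
      (∀ s, ¬ lt s s) ∧ (∀ s t u, lt s t → lt t u → lt s u) ∧ (∀ s, IsMaxCons (label s)) ∧
      ∀ α ∈ Δ, ∀ β ∈ Δ, (v (cf α β) ↔
        ∀ s, label s α → (∀ t, label t α → ¬ lt t s) → label s β) := by
  have hf := isPreferential_core (Δ := Δ) hv
  choose label hl hl' using fun s : PrefState (core v Δ) => exists_isMaxCons_of_mem_core hv s.2
  refine ⟨PrefState (core v Δ), inferInstance, PrefState.lt, label, PrefState.lt_irrefl hf,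
    fun _ _ _ => PrefState.lt_trans hf, hl, fun α hα β hβ => ?_⟩
  have hdef : ∀ δ (hδ : δ ∈ Δ), Defines Δ δ {t | t ⟨δ, hδ⟩} := fun δ hδ u hu => Iff.rfl
  have h := fun s => hl' s ⟨α, hα⟩
  have h' := fun s => hl' s ⟨β, hβ⟩
  simp only at h h'
  rw [← Entails.iff hv (hdef α hα) (hdef β hβ), entails_iff_core_subset hv,
    PrefState.subset_iff hf]
  simp only [h, h', Set.mem_ofPred_eq]

end Form

end PBT

namespace PBT

/-! ### Countably many histories suffice -/

namespace BTFrame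

/-- The frame with the same moments and only some of the histories. -/
def restrict (F : BTFrame) (K : Set (Set F.M)) (hK : K ⊆ F.histories) : BTFrame :=
  { F with
    histories := K
    maximal := fun h hh => F.maximal h (hK hh) }

/-- A point of a restricted frame as a point of the frame. -/
def Point.unrestrict {F : BTFrame} {K : Set (Set F.M)} {hK : K ⊆ F.histories}
    (x : (F.restrict K hK).Point) : F.Point :=
  ⟨x.moment, x.history, hK x.history_mem, x.moment_mem⟩

theorem countable_point (F : BTFrame) (h : F.histories.Countable) : Countable F.Point := by
  have := F.countable
  have := h.to_subtype
  refine Function.Injective.countable (β := F.M × F.histories)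
    (f := fun x => (x.moment, ⟨x.history, x.history_mem⟩)) fun x y hxy => ?_
  simp only [Prod.mk.injEq, Subtype.mk.injEq] at hxy
  exact Point.ext' hxy.1 hxy.2

end BTFrame

instance : Countable OForm := by
  refine Function.Injective.countable (f := fun φ : OForm => φ.toForm.code) fun φ ψ h => ?_
  have := congrArg Form.toOForm (Form.code_injective h)
  rwa [Form.toOForm_toForm, Form.toOForm_toForm] at this

/-- A satisfiable formula is satisfiable in a frame with countably many points. -/
theorem BTFrame.exists_countable (F : BTFrame) (V : ℕ → Set F.Point) (x : F.Point) :
    ∃ (F' : BTFrame) (V' : ℕ → Set F'.Point) (x' : F'.Point), Countable F'.Point ∧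
      ∀ φ, F'.Sat V' x' φ ↔ F.Sat V x φ := by
  classical
  have := F.countable
  have : Nonempty F.Point := ⟨x⟩
  -- Only `□` looks at other histories. It suffices to keep, for each moment and formula, one
  -- history refuting the formula there, if any exists; both moments and formulas are countable.
  choose! c hc using fun (q : F.M × OForm) (h : ∃ y : F.Point, y.moment = q.1 ∧ ¬ F.Sat V y q.2) => h
  set K : Set (Set F.M) := insert x.history (Set.range fun q => (c q).history) with hKdef
  have hK : K ⊆ F.histories := by
    rintro _ (rfl | ⟨q, rfl⟩)
    exacts [x.history_mem, (c q).history_mem]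
  have key : ∀ (φ : OForm) (y : (F.restrict K hK).Point),
      (F.restrict K hK).Sat (fun p => {z | z.unrestrict ∈ V p}) y φ ↔ F.Sat V y.unrestrict φ := by
    intro φ
    induction φ with
    | var p => exact fun y => Iff.rfl
    | neg φ ih => exact fun y => not_congr (ih y)
    | disj φ ψ ih ih' => exact fun y => or_congr (ih y) (ih' y)
    | G φ ih =>
      refine fun y => ⟨fun h z hz => ?_, fun h z hz => (ih z).2 (h _ hz)⟩
      exact (ih ⟨z.moment, z.history, hz.1 ▸ y.history_mem, z.moment_mem⟩).1 (h _ hz)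
    | H φ ih =>
      refine fun y => ⟨fun h z hz => ?_, fun h z hz => (ih z).2 (h _ hz)⟩
      exact (ih ⟨z.moment, z.history, hz.1.symm ▸ y.history_mem, z.moment_mem⟩).1 (h _ hz)
    | box φ ih =>
      refine fun y => ⟨fun h z hz => ?_, fun h z hz => (ih z).2 (h _ hz)⟩
      by_contra hno
      obtain ⟨hm, hns⟩ := hc (y.moment, φ) ⟨z, hz.symm, hno⟩
      exact hns ((ih ⟨(c (y.moment, φ)).moment, (c (y.moment, φ)).history,
        .inr ⟨_, rfl⟩, (c (y.moment, φ)).moment_mem⟩).1 (h _ hm.symm))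
  refine ⟨F.restrict K hK, _, ⟨x.moment, x.history, .inl rfl, x.moment_mem⟩,
    BTFrame.countable_point _ ((Set.countable_range _).insert _), fun φ => key φ _⟩

/-! ### Disjoint unions of branching time frames -/

/-- The disjoint union of relations. -/
inductive SigmaRel {I : Type} {W : I → Type} (r : ∀ i, W i → W i → Prop) :
    (Σ i, W i) → (Σ i, W i) → Prop
  | mk {i : I} {x y : W i} : r i x y → SigmaRel r ⟨i, x⟩ ⟨i, y⟩

theorem sigmaRel_iff {I : Type} {W : I → Type} {r : ∀ i, W i → W i → Prop} {i : I} {x y : W i} :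
    SigmaRel r ⟨i, x⟩ ⟨i, y⟩ ↔ r i x y :=
  ⟨fun h => by cases h; assumption, .mk⟩

/-- The relations are, up to isomorphism, those between the points of a branching time frame. -/
def IsBranching (W : Type) (earlier rBox : W → W → Prop) : Prop :=
  ∃ (F : BTFrame) (e : W ≃ F.Point),
    (∀ x y, earlier x y ↔ F.pointEarlier (e x) (e y)) ∧
    (∀ x y, rBox x y ↔ F.sameMoment (e x) (e y))

theorem BTFrame.history_nonempty (F : BTFrame) {h : Set F.M} (hh : h ∈ F.histories) :
    h.Nonempty := by
  obtain ⟨m⟩ := F.nonempty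
  by_contra hne
  rw [Set.not_nonempty_iff_eq_empty] at hne
  have := (F.maximal h hh).2 (t := {m}) Set.subsingleton_singleton.isChain (by simp [hne])
  simp [hne] at this

/-- The disjoint union of branching time frames. -/
def BTFrame.sigma {I : Type} [Nonempty I] [Countable I] (F : I → BTFrame) : BTFrame where
  M := Σ i, (F i).M
  nonempty := by
    obtain ⟨i⟩ := ‹Nonempty I›
    obtain ⟨m⟩ := (F i).nonempty
    exact ⟨⟨i, m⟩⟩
  countable := by
    have := fun i => (F i).countable
    infer_instance
  earlier := SigmaRel fun i => (F i).earlier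
  irrefl := by
    rintro ⟨i, m⟩ h
    exact (F i).irrefl m (sigmaRel_iff.1 h)
  trans := by
    rintro _ _ _ ⟨h⟩ h'
    cases h' with
    | mk h' => exact .mk ((F _).trans _ _ _ h h')
  backward_linear := by
    rintro _ _ _ ⟨h⟩ h'
    cases h' with
    | mk h' =>
      rcases (F _).backward_linear _ _ _ h h' with h | h | rfl
      exacts [.inl (.mk h), .inr (.inl (.mk h)), .inr (.inr rfl)]
  histories := {h | ∃ i, ∃ k ∈ (F i).histories, h = Sigma.mk i '' k}
  maximal := by
    rintro _ ⟨i, k, hk, rfl⟩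
    have hmax := (F i).maximal k hk
    refine ⟨?_, fun t ht hkt => hkt.antisymm ?_⟩
    · rintro _ ⟨x, hx, rfl⟩ _ ⟨y, hy, rfl⟩ hne
      exact (hmax.1 hx hy fun e => hne (e ▸ rfl)).imp .mk .mk
    · obtain ⟨x, hx⟩ := (F i).history_nonempty hk
      -- Within component `i` the chain `t` is exactly `k` by maximality. It cannot leave the
      -- component, because each of its elements is comparable with a point `x` of `k`.
      have hpre : k = {y | (⟨i, y⟩ : Σ i, (F i).M) ∈ t} := by
        refine hmax.2 (fun y hy z hz hne => ?_) fun y hy => hkt ⟨y, hy, rfl⟩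
        refine (ht hy hz fun e => hne ?_).imp sigmaRel_iff.1 sigmaRel_iff.1
        exact sigma_mk_injective (β := fun i => (F i).M) e
      rintro ⟨j, y⟩ hy
      have hij : j = i := by
        by_contra hne
        rcases ht hy (hkt ⟨x, hx, rfl⟩) fun e => hne (congrArg Sigma.fst e) with h | h
        · cases h; exact hne rfl
        · cases h; exact hne rfl
      subst hij
      exact ⟨y, by rw [hpre]; exact hy, rfl⟩

theorem IsBranching.sigma {I : Type} [Nonempty I] [Countable I] {W : I → Type}
    {earlier rBox : ∀ i, W i → W i → Prop} (h : ∀ i, IsBranching (W i) (earlier i) (rBox i)) :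
    IsBranching (Σ i, W i) (SigmaRel earlier) (SigmaRel rBox) := by
  choose F e he hr using h
  let f : (Σ i, W i) → (BTFrame.sigma F).Point := fun x =>
    ⟨⟨x.1, (e x.1 x.2).moment⟩, Sigma.mk x.1 '' (e x.1 x.2).history,
      ⟨x.1, _, (e x.1 x.2).history_mem, rfl⟩, ⟨_, (e x.1 x.2).moment_mem, rfl⟩⟩
  have hist : ∀ {i} {x y : W i}, (f ⟨i, x⟩).history = (f ⟨i, y⟩).history →
      (e i x).history = (e i y).history := fun h =>
    Set.image_injective.2 (sigma_mk_injective (β := fun i => (F i).M)) h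
  have mom : ∀ {i} {x y : W i}, (f ⟨i, x⟩).moment = (f ⟨i, y⟩).moment →
      (e i x).moment = (e i y).moment := fun h =>
    sigma_mk_injective (β := fun i => (F i).M) h
  have hf : Function.Bijective f := by
    constructor
    · rintro ⟨i, x⟩ ⟨j, y⟩ hxy
      obtain rfl : i = j := congrArg (fun z => z.moment.1) hxy
      have := BTFrame.Point.ext' (mom (congrArg _ hxy)) (hist (congrArg _ hxy))
      rw [(e i).injective this]
    · rintro ⟨_, _, ⟨i, k, hk, rfl⟩, ⟨m, hm, rfl⟩⟩
      refine ⟨⟨i, (e i).symm ⟨m, k, hk, hm⟩⟩, BTFrame.Point.ext' ?_ ?_⟩ <;> simp [f] <;> rfl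
  refine ⟨BTFrame.sigma F, Equiv.ofBijective f hf, ?_, ?_⟩
  · rintro ⟨i, x⟩ ⟨j, y⟩
    constructor
    · rintro ⟨h⟩
      rw [he] at h
      exact ⟨congrArg (Sigma.mk i '' ·) h.1, .mk h.2⟩
    · rintro ⟨h₁, h₂⟩
      obtain rfl : i = j := by
        change SigmaRel (fun i => (F i).earlier) ⟨i, (e i x).moment⟩ ⟨j, (e j y).moment⟩ at h₂
        cases h₂; rfl
      exact .mk ((he _ _ _).2 ⟨hist h₁, sigmaRel_iff.1 h₂⟩)
  · rintro ⟨i, x⟩ ⟨j, y⟩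
    constructor
    · rintro ⟨h⟩
      rw [hr] at h
      exact congrArg (Sigma.mk i) h
    · intro h
      obtain rfl : i = j := congrArg Sigma.fst h
      exact .mk ((hr _ _ _).2 (mom h))

/-! ### Models with indexed accessible worlds -/

/-- Models over combined frames in which the finitely many worlds accessible from `w` are indexed by
a type `S w`. -/
structure Model where
  W : Type
  nonempty : Nonempty W
  countable : Countable W
  earlier : W → W → Prop
  rBox : W → W → Prop
  branching : IsBranching W earlier rBox
  S : W → Type
  finite : ∀ w, Finite (S w)
  pt : ∀ w, S w → W
  pt_injective : ∀ w, Function.Injective (pt w)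
  lt : ∀ w, S w → S w → Prop
  lt_irrefl : ∀ w s, ¬ lt w s s
  lt_trans : ∀ w s t u, lt w s t → lt w t u → lt w s u
  val : ℕ → Set W

namespace Model

/-- Truth at a world. -/
def Sat (M : Model) : M.W → Form → Prop
  | w, .var p => w ∈ M.val p
  | w, .neg φ => ¬ Sat M w φ
  | w, .disj φ ψ => Sat M w φ ∨ Sat M w ψ
  | w, .cf φ ψ => ∀ s, Sat M (M.pt w s) φ →
      (∀ t, Sat M (M.pt w t) φ → ¬ M.lt w t s) → Sat M (M.pt w s) ψ
  | w, .G φ => ∀ v, M.earlier w v → Sat M v φ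
  | w, .H φ => ∀ v, M.earlier v w → Sat M v φ
  | w, .box φ => ∀ v, M.rBox w v → Sat M v φ

theorem isBoolean_sat (M : Model) (w : M.W) : Form.IsBoolean (M.Sat w) :=
  ⟨fun _ => Iff.rfl, fun _ _ => Iff.rfl⟩

/-- The combined frame of a model. -/
def toFrame (M : Model) : Frame where
  W := M.W
  nonempty := M.nonempty
  countable := M.countable
  earlier := M.earlier
  rBox := M.rBox
  branching := M.branching
  acc w := Set.range (M.pt w)
  closer w x y := ∃ s t, M.lt w s t ∧ M.pt w s = x ∧ M.pt w t = y
  closer_mem := by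
    rintro w _ _ ⟨s, t, -, rfl, rfl⟩
    exact ⟨⟨s, rfl⟩, ⟨t, rfl⟩⟩
  closer_irrefl := by
    rintro w _ ⟨s, t, h, rfl, he⟩
    exact M.lt_irrefl w s (M.pt_injective w he ▸ h)
  closer_trans := by
    rintro w _ _ _ ⟨s, t, h, rfl, rfl⟩ ⟨t', u, h', he, rfl⟩
    exact ⟨s, u, M.lt_trans w _ _ _ h (M.pt_injective w he ▸ h'), rfl, rfl⟩
  limit := by
    intro w X hX x hx
    obtain ⟨s, rfl⟩ := hX hx
    have := M.finite w
    have : IsTrans _ (M.lt w) := ⟨M.lt_trans w⟩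
    have : Std.Irrefl (M.lt w) := ⟨M.lt_irrefl w⟩
    have hwf : WellFounded (M.lt w) := Finite.wellFounded_of_trans_of_irrefl _
    -- Minimising only over states equal to or below `s` yields a minimal element of `X` that is
    -- also comparable with `s`.
    obtain ⟨t, ⟨htX, hts⟩, hmin⟩ := hwf.has_min
      {t | M.pt w t ∈ X ∧ (t = s ∨ M.lt w t s)} ⟨s, hx, .inl rfl⟩
    refine ⟨M.pt w t, htX, hts.imp (congrArg _) fun h => ⟨t, s, h, rfl, rfl⟩, ?_⟩
    rintro z hz ⟨u, t', h, rfl, he⟩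
    rw [M.pt_injective w he] at h
    refine hmin u ⟨hz, .inr ?_⟩ h
    rcases hts with rfl | hts
    exacts [h, M.lt_trans w _ _ _ h hts]

theorem sat_toFrame (M : Model) (w : M.W) (φ : Form) :
    M.toFrame.Sat M.val w φ ↔ M.Sat w φ := by
  induction φ generalizing w with
  | var p => exact Iff.rfl
  | neg φ ih => exact not_congr (ih w)
  | disj φ ψ ih ih' => exact or_congr (ih w) (ih' w)
  | G φ ih | H φ ih | box φ ih => exact forall_congr' fun v => imp_congr_right fun _ => ih v
  | cf φ ψ ih ih' =>
    refine Set.forall_mem_range.trans (forall_congr' fun s => ?_)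
    refine imp_congr (ih _) (imp_congr ?_ (ih' _))
    refine Set.forall_mem_range.trans (forall_congr' fun t => imp_congr (ih _) (not_congr ?_))
    refine ⟨fun ⟨s', t', h, hs, ht⟩ => ?_, fun h => ⟨t, s, h, rfl, rfl⟩⟩
    rwa [M.pt_injective w hs, M.pt_injective w ht] at h

end Model

/-! ### Grafting models onto the points of a branching time frame -/

/-- A branching time frame with valuation, together with a finite partial order of pointed models for
each of its points. -/
structure Graft where
  B : BTFrame
  countable : Countable B.Point
  nonempty : Nonempty B.Point
  val : ℕ → Set B.Point
  S : B.Point → Type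
  finite : ∀ w, Finite (S w)
  lt : ∀ w, S w → S w → Prop
  lt_irrefl : ∀ w s, ¬ lt w s s
  lt_trans : ∀ w s t u, lt w s t → lt w t u → lt w s u
  model : ∀ w, S w → Model
  root : ∀ w s, (model w s).W

namespace Graft

variable (D : Graft)

/-- The components of the grafted model: the branching time frame and the pointed models. -/
abbrev Index : Type := Option (Σ w, D.S w)

/-- The worlds of a component. -/
def World : D.Index → Type
  | none => D.B.Point
  | some j => (D.model j.1 j.2).W

/-- The temporal order of a component. -/
def earlier : ∀ i, D.World i → D.World i → Prop
  | none => D.B.pointEarlier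
  | some j => (D.model j.1 j.2).earlier

/-- Historical accessibility in a component. -/
def rBox : ∀ i, D.World i → D.World i → Prop
  | none => D.B.sameMoment
  | some j => (D.model j.1 j.2).rBox

/-- The model in which the roots of the pointed models for `w` are the worlds accessible from `w`. -/
def toModel : Model where
  W := Σ i, D.World i
  nonempty := D.nonempty.map fun x => ⟨none, x⟩
  countable := by
    have := D.countable
    have : ∀ w, Countable (D.S w) := fun w => have := D.finite w; Finite.to_countable
    have : ∀ i, Countable (D.World i)
      | none => D.countable
      | some j => (D.model j.1 j.2).countable
    infer_instance
  earlier := SigmaRel D.earlier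
  rBox := SigmaRel D.rBox
  branching := by
    have := D.countable
    have : ∀ w, Countable (D.S w) := fun w => have := D.finite w; Finite.to_countable
    exact IsBranching.sigma fun
      | none => ⟨D.B, Equiv.refl _, fun _ _ => Iff.rfl, fun _ _ => Iff.rfl⟩
      | some j => (D.model j.1 j.2).branching
  S
    | ⟨none, w⟩ => D.S w
    | ⟨some j, x⟩ => (D.model j.1 j.2).S x
  finite
    | ⟨none, w⟩ => D.finite w
    | ⟨some j, x⟩ => (D.model j.1 j.2).finite x
  pt
    -- Each pair `(w, s)` has its own component, so distinct states give distinct worlds even when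
    -- their pointed models coincide.
    | ⟨none, w⟩, s => ⟨some ⟨w, s⟩, D.root w s⟩
    | ⟨some j, x⟩, s => ⟨some j, (D.model j.1 j.2).pt x s⟩
  pt_injective
    | ⟨none, w⟩ => fun s t h => by
      have h' : (some ⟨w, s⟩ : D.Index) = some ⟨w, t⟩ := congrArg Sigma.fst h
      exact sigma_mk_injective (β := D.S) (Option.some_injective _ h')
    | ⟨some j, x⟩ => fun s t h => (D.model j.1 j.2).pt_injective x
      (sigma_mk_injective (β := D.World) h)
  lt
    | ⟨none, w⟩ => D.lt w
    | ⟨some j, x⟩ => (D.model j.1 j.2).lt x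
  lt_irrefl
    | ⟨none, w⟩ => D.lt_irrefl w
    | ⟨some j, x⟩ => (D.model j.1 j.2).lt_irrefl x
  lt_trans
    | ⟨none, w⟩ => D.lt_trans w
    | ⟨some j, x⟩ => (D.model j.1 j.2).lt_trans x
  val p
    | ⟨none, w⟩ => w ∈ D.val p
    | ⟨some j, x⟩ => x ∈ (D.model j.1 j.2).val p

variable {D}

theorem forall_sigmaRel {I : Type} {W : I → Type} {r : ∀ i, W i → W i → Prop} {i : I} {x : W i}
    {P : (Σ i, W i) → Prop} : (∀ v, SigmaRel r ⟨i, x⟩ v → P v) ↔ ∀ y, r i x y → P ⟨i, y⟩ :=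
  ⟨fun h y hy => h _ (.mk hy), fun h v hv => by cases hv with | mk hv => exact h _ hv⟩

theorem forall_sigmaRel' {I : Type} {W : I → Type} {r : ∀ i, W i → W i → Prop} {i : I} {x : W i}
    {P : (Σ i, W i) → Prop} : (∀ v, SigmaRel r v ⟨i, x⟩ → P v) ↔ ∀ y, r i y x → P ⟨i, y⟩ :=
  ⟨fun h y hy => h _ (.mk hy), fun h v hv => by cases hv with | mk hv => exact h _ hv⟩

/-- The relations and accessible worlds of a grafted component never leave it. -/
theorem sat_some (j : Σ w, D.S w) (x : (D.model j.1 j.2).W) (φ : Form) :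
    D.toModel.Sat ⟨some j, x⟩ φ ↔ (D.model j.1 j.2).Sat x φ := by
  induction φ generalizing x with
  | var p => exact Iff.rfl
  | neg φ ih => exact not_congr (ih x)
  | disj φ ψ ih ih' => exact or_congr (ih x) (ih' x)
  | G φ ih => exact forall_sigmaRel.trans (forall_congr' fun v => imp_congr_right fun _ => ih v)
  | H φ ih => exact forall_sigmaRel'.trans (forall_congr' fun v => imp_congr_right fun _ => ih v)
  | box φ ih => exact forall_sigmaRel.trans (forall_congr' fun v => imp_congr_right fun _ => ih v)
  | cf φ ψ ih ih' =>
    exact forall_congr' fun s => imp_congr (ih _) (imp_congr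
      (forall_congr' fun t => imp_congr_left (ih _)) (ih' _))

theorem sat_none_cf (w : D.B.Point) (φ ψ : Form) :
    D.toModel.Sat ⟨none, w⟩ (.cf φ ψ) ↔ ∀ s, (D.model w s).Sat (D.root w s) φ →
      (∀ t, (D.model w t).Sat (D.root w t) φ → ¬ D.lt w t s) →
        (D.model w s).Sat (D.root w s) ψ :=
  forall_congr' fun s => imp_congr (sat_some ⟨w, s⟩ _ φ) (imp_congr
    (forall_congr' fun t => imp_congr_left (sat_some ⟨w, t⟩ _ φ)) (sat_some ⟨w, s⟩ _ ψ))

end Graft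

/-! ### Completeness -/

namespace Form

/-- The OBTL formula in which variables stand for the outermost counterfactuals. -/
def surrogate : Form → OForm
  | var p => .var (code (var p))
  | neg φ => .neg φ.surrogate
  | disj φ ψ => .disj φ.surrogate ψ.surrogate
  | cf φ ψ => .var (code (cf φ ψ))
  | G φ => .G φ.surrogate
  | H φ => .H φ.surrogate
  | box φ => .box φ.surrogate

theorem subst_surrogate (φ : Form) : φ.surrogate.subst decode = φ := by
  induction φ <;> simp_all [surrogate, OForm.subst, decode_code]

theorem isBoolean_sat_surrogate (B : BTFrame) (V : ℕ → Set B.Point) (w : B.Point) :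
    IsBoolean fun φ => B.Sat V w φ.surrogate :=
  ⟨fun _ => Iff.rfl, fun _ _ => Iff.rfl⟩

/-- The outermost counterfactuals of a formula. -/
def cfs : Form → List (Form × Form)
  | var _ => []
  | neg φ => φ.cfs
  | disj φ ψ => φ.cfs ++ ψ.cfs
  | cf φ ψ => [(φ, ψ)]
  | G φ => φ.cfs
  | H φ => φ.cfs
  | box φ => φ.cfs

theorem cfDepth_lt_of_mem_cfs {φ : Form} {q : Form × Form} (h : q ∈ φ.cfs) :
    q.1.cfDepth < φ.cfDepth ∧ q.2.cfDepth < φ.cfDepth := by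
  induction φ with
  | var => simp [cfs] at h
  | neg φ ih | G φ ih | H φ ih | box φ ih => exact ih h
  | disj φ ψ ih ih' =>
    rcases List.mem_append.1 h with h | h
    · exact ⟨lt_max_of_lt_left (ih h).1, lt_max_of_lt_left (ih h).2⟩
    · exact ⟨lt_max_of_lt_right (ih' h).1, lt_max_of_lt_right (ih' h).2⟩
  | cf φ ψ =>
    obtain rfl := List.mem_singleton.1 h
    exact ⟨Nat.lt_succ_of_le (le_max_left _ _), Nat.lt_succ_of_le (le_max_right _ _)⟩

/-- `θ` holds wherever the evaluation of the formula leads. -/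
def guard (θ : Form) : Form → Form
  | var _ => θ
  | neg φ => guard θ φ
  | disj φ ψ => conj (guard θ φ) (guard θ ψ)
  | cf _ _ => θ
  | G φ => G (guard θ φ)
  | H φ => H (guard θ φ)
  | box φ => box (guard θ φ)

theorem Prov.guard {θ : Form} (h : Prov θ) (φ : Form) : Prov (guard θ φ) := by
  induction φ with
  | var | cf => exact h
  | neg φ ih => exact ih
  | disj φ ψ ih ih' =>
    refine ih.mono_taut₂ ih' fun v hn hd => ?_
    simp only [imp, Form.guard, conj, hn, hd]; tauto
  | G φ ih => exact .necG _ ih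
  | H φ ih => exact .necH _ ih
  | box φ ih => exact .necBox _ ih

/-- Agreement on counterfactuals is known only where `θ` holds; `guard θ φ` supplies `θ` at exactly
the points where the evaluation of `φ` needs it. -/
theorem sat_graft_iff {D : Graft} {V : ℕ → Set D.B.Point} {θ : Form} (φ : Form)
    (hval : ∀ p w, w ∈ D.val p ↔ w ∈ V (code (var p)))
    (hcf : ∀ w, D.B.Sat V w θ.surrogate → ∀ q ∈ φ.cfs,
      (D.toModel.Sat ⟨none, w⟩ (cf q.1 q.2) ↔ D.B.Sat V w (cf q.1 q.2).surrogate))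
    (w : D.B.Point) (hw : D.B.Sat V w (guard θ φ).surrogate) :
    D.toModel.Sat ⟨none, w⟩ φ ↔ D.B.Sat V w φ.surrogate := by
  induction φ generalizing w with
  | var p => exact hval p w
  | neg φ ih => exact not_congr (ih hcf w hw)
  | disj φ ψ ih ih' =>
    have hw' := ((isBoolean_sat_surrogate D.B V w).conj _ _).1 hw
    exact or_congr (ih (fun w h q hq => hcf w h q (List.mem_append_left _ hq)) w hw'.1)
      (ih' (fun w h q hq => hcf w h q (List.mem_append_right _ hq)) w hw'.2)
  | cf φ ψ => exact hcf w hw (φ, ψ) (List.mem_singleton.2 rfl)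
  | G φ ih => exact Graft.forall_sigmaRel.trans (forall_congr' fun v =>
      forall_congr' fun hv => ih hcf v (hw v hv))
  | H φ ih => exact Graft.forall_sigmaRel'.trans (forall_congr' fun v =>
      forall_congr' fun hv => ih hcf v (hw v hv))
  | box φ ih => exact Graft.forall_sigmaRel.trans (forall_congr' fun v =>
      forall_congr' fun hv => ih hcf v (hw v hv))

/-- Provided that OBTL is complete, a consistent formula holds at some point of some branching time
frame with countably many points, if variables stand for its outermost counterfactuals. -/
theorem exists_sat_surrogate (hO : ∀ φ : OForm, φ.Valid → φ.Prov) {φ : Form}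
    (h : ¬ Prov (neg φ)) :
    ∃ (B : BTFrame) (V : ℕ → Set B.Point) (x : B.Point), Countable B.Point ∧
      B.Sat V x φ.surrogate := by
  -- Were the negated surrogate valid, it would be an OBTL theorem, and substituting the
  -- counterfactuals back would prove `neg φ`.
  have hv : ¬ (OForm.neg φ.surrogate).Valid := fun hv => h (by
    simpa only [OForm.subst, subst_surrogate] using (hO _ hv).subst decode)
  simp only [OForm.Valid, not_forall] at hv
  obtain ⟨F, V, x, hx⟩ := hv
  obtain ⟨F', V', x', hc, hx'⟩ := F.exists_countable V x
  exact ⟨F', V', x', hc, (hx' _).2 (not_not.1 hx)⟩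

/-- A maximal consistent set has a finite preferential order of pointed models for its
counterfactuals, if the consistent formulas of smaller depth have models. -/
theorem IsMaxCons.exists_models {v : Form → Prop} (hv : IsMaxCons v) {k : ℕ}
    (ih : ∀ φ, cfDepth φ ≤ k → ¬ Prov (neg φ) → ∃ (M : Model) (w : M.W), M.Sat w φ)
    (L : List (Form × Form)) (hL : ∀ q ∈ L, q.1.cfDepth ≤ k ∧ q.2.cfDepth ≤ k) :
    ∃ (S : Type) (lt : S → S → Prop) (M : S → Model) (root : ∀ s, (M s).W), Finite S ∧
      (∀ s, ¬ lt s s) ∧ (∀ s t u, lt s t → lt t u → lt s u) ∧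
      ∀ q ∈ L, (v (cf q.1 q.2) ↔ ∀ s, (M s).Sat (root s) q.1 →
        (∀ t, (M t).Sat (root t) q.1 → ¬ lt t s) → (M s).Sat (root s) q.2) := by
  set Δ := L.map Prod.fst ++ L.map Prod.snd with hΔ
  have hdep : ∀ δ ∈ Δ, δ.cfDepth ≤ k := by
    intro δ hδ
    simp only [hΔ, List.mem_append, List.mem_map] at hδ
    rcases hδ with ⟨q, hq, rfl⟩ | ⟨q, hq, rfl⟩
    exacts [(hL q hq).1, (hL q hq).2]
  obtain ⟨S, hS, lt, label, irr, tr, hl, hcf⟩ := hv.exists_preferential Δ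
  have hM : ∀ s, ∃ (M : Model) (w : M.W), ∀ δ ∈ Δ, (M.Sat w δ ↔ label s δ) := by
    intro s
    -- The formula `a` fixes all truth values on `Δ` without exceeding depth `k`. It does so for
    -- every Boolean assignment, hence also for truth in the model obtained from `ih`.
    obtain ⟨a, hak, ha⟩ := exists_definition Δ hdep (fun u => ∀ δ ∈ Δ, (u δ ↔ label s δ))
      fun u u' huu' hu δ hδ => (huu' δ hδ).symm.trans (hu δ hδ)
    have hc : ¬ Prov (neg a) := fun hp => ((hl s).neg a).1 ((hl s).of_prov _ hp)
      ((ha _ (hl s).toIsBoolean).2 fun _ _ => Iff.rfl)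
    obtain ⟨M, w, hw⟩ := ih a hak hc
    exact ⟨M, w, (ha _ (M.isBoolean_sat w)).1 hw⟩
  choose M root hroot using hM
  refine ⟨S, lt, M, root, hS, irr, tr, fun q hq => ?_⟩
  have h₁ : q.1 ∈ Δ := List.mem_append_left _ (List.mem_map_of_mem hq)
  have h₂ : q.2 ∈ Δ := List.mem_append_right _ (List.mem_map_of_mem hq)
  simp only [hcf _ h₁ _ h₂, hroot _ _ h₁, hroot _ _ h₂]

theorem exists_model (hO : ∀ φ : OForm, φ.Valid → φ.Prov) (n : ℕ) (φ : Form)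
    (hn : φ.cfDepth < n) (h : ¬ Prov (neg φ)) : ∃ (M : Model) (w : M.W), M.Sat w φ := by
  induction n generalizing φ with
  | zero => exact absurd hn (Nat.not_lt_zero _)
  | succ n ih =>
    obtain ⟨θ, -, hθ⟩ := exists_definition (φ.cfs.map fun q => cf q.1 q.2) (k := φ.cfDepth)
      (fun δ hδ => by
        obtain ⟨q, hq, rfl⟩ := List.mem_map.1 hδ
        exact max_lt (cfDepth_lt_of_mem_cfs hq).1 (cfDepth_lt_of_mem_cfs hq).2)
      -- `θ` says that the outermost counterfactuals of `φ` have the values that some maximal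
      -- consistent set gives them.
      (fun v => ∃ u, IsMaxCons u ∧ ∀ q ∈ φ.cfs, (u (cf q.1 q.2) ↔ v (cf q.1 q.2)))
      fun v v' hvv' ⟨u, hu, huv⟩ => ⟨u, hu, fun q hq =>
        (huv q hq).trans (hvv' _ (List.mem_map_of_mem (f := fun q => cf q.1 q.2) hq))⟩
    have hθp : Prov θ := prov_iff_forall_isMaxCons.2 fun v hv =>
      (hθ v hv.toIsBoolean).2 ⟨v, hv, fun _ _ => Iff.rfl⟩
    have hc : ¬ Prov (neg (conj φ (guard θ φ))) := fun hp =>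
      h ((hθp.guard φ).mono_taut₂ hp fun v hn hd => by
        simp only [imp, conj, hn, hd]; tauto)
    obtain ⟨B, V, x, hB, hx⟩ := exists_sat_surrogate hO hc
    rw [(isBoolean_sat_surrogate B V x).conj] at hx
    have hmod : ∀ w : B.Point, ∃ (S : Type) (lt : S → S → Prop) (M : S → Model)
        (root : ∀ s, (M s).W), Finite S ∧ (∀ s, ¬ lt s s) ∧
        (∀ s t u, lt s t → lt t u → lt s u) ∧ (B.Sat V w θ.surrogate → ∀ q ∈ φ.cfs,
          (B.Sat V w (cf q.1 q.2).surrogate ↔ ∀ s, (M s).Sat (root s) q.1 →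
            (∀ t, (M t).Sat (root t) q.1 → ¬ lt t s) → (M s).Sat (root s) q.2)) := by
      intro w
      -- The arguments of these counterfactuals have depth below that of `φ`, so at most `n - 1`.
      -- For `n = 0` there are none, and where `θ` fails nothing is required; no accessible worlds
      -- are needed then.
      by_cases hw : B.Sat V w θ.surrogate ∧ 0 < n
      · obtain ⟨u, hu, huw⟩ := (hθ _ (isBoolean_sat_surrogate B V w)).1 hw.1
        obtain ⟨S, lt, M, root, hS, irr, tr, hcf⟩ := hu.exists_models
          (k := n - 1) (fun ψ hψ => ih ψ (by omega)) φ.cfs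
          (fun q hq => by
            have := cfDepth_lt_of_mem_cfs hq
            omega)
        exact ⟨S, lt, M, root, hS, irr, tr, fun _ q hq => (huw q hq).symm.trans (hcf q hq)⟩
      · exact ⟨Empty, fun _ _ => False, nofun, nofun, inferInstance, nofun, nofun,
          fun h q hq => by
            have := cfDepth_lt_of_mem_cfs hq
            exact absurd ⟨h, by omega⟩ hw⟩
    choose S lt M root hS irr tr hcf using hmod
    let D : Graft := ⟨B, hB, ⟨x⟩, fun p => V (code (var p)), S, hS, lt, irr, tr, M, root⟩
    exact ⟨D.toModel, ⟨none, x⟩, (sat_graft_iff (D := D) (θ := θ) φ (fun _ _ => Iff.rfl)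
      (fun w hw q hq => (Graft.sat_none_cf (D := D) w q.1 q.2).trans (hcf w hw q hq).symm)
      x hx.2).2 hx.1⟩

theorem Valid.prov (hO : ∀ φ : OForm, φ.Valid → φ.Prov) {φ : Form} (h : φ.Valid) : φ.Prov := by
  by_contra hφ
  obtain ⟨M, w, hw⟩ := exists_model hO _ (neg φ) (Nat.lt_succ_self _) fun hp =>
    hφ (hp.mono_taut fun v hn hd => by simp only [imp, hn, hd]; tauto)
  exact hw ((M.sat_toFrame w φ).1 (h M.toFrame M.val w))

end Form

end PBT

theorem mainTheorem1 :
    -- soundness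
    (∀ φ : PBT.Form, φ.Prov → φ.Valid) ∧
    -- completeness, provided that OBTL is complete for branching time frames
    ((∀ φ : PBT.OForm, φ.Valid → φ.Prov) → ∀ φ : PBT.Form, φ.Valid → φ.Prov) ∧
    -- conservative extension of both components
    (∀ φ : PBT.PForm, φ.toForm.Prov ↔ φ.Prov) ∧
    (∀ φ : PBT.OForm, φ.toForm.Prov ↔ φ.Prov) :=
  ⟨fun _ h => h.valid, fun hO _ h => h.prov hO, PBT.PForm.prov_toForm_iff,
    PBT.OForm.prov_toForm_iff⟩
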